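/- **Setting.** For probability measures $P,Q$ on a measurable space let $T(P,Q)(\alpha)=\inf_\phi\{1-\mathbb E_Q[\phi] : \mathbb E_P[\phi]\le\alpha\}$, $\alpha\in[0,1]$, the infimum being over measurable $\phi$ with values in $[0,1]$. A *trade-off function* is a convex, continuous, non-increasing $f:[0,1]\to[0,1]$ with $f(x)\le 1-x$. Write $G_\mu=T(\mathcal N(0,1),\mathcal N(\mu,1))$, $\Phi$ for the standard normal distribution function, $f^{-1}(\alpha)=\inf\{t\in[0,1]: f(t)\le\alpha\}$ (equal to $1$ if no such $t$ exists), and $f^{**}$ for the double conjugate of a function $f$ on $[0,1]$, where $f^*(y)=\sup_x\{yx-f(x)\}$. A trade-off function $f$ is symmetric if $f^{-1}=f$. Let $m,s\ge 1$ with $ms\mid N$, let $E\ge 0$, $C,\sigma>0$, and let $\mathrm{Sample}_{s,m}$ be a random procedure that outputs sets $S_{b,h}\subseteq\{1,\dots,N\}$ ($1\le b\le N/(ms)$, $1\le h\le m$), each of size $s$, with $S_{b,1},\dots,S_{b,m}$ pairwise disjoint for every $b$. The mechanism $\mathcal M$ works on a data set of size $N$, listed as $\xi_1,\dots,\xi_N$,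 with models in $\mathbb R^n$, $n\ge 1$. In each epoch $e=1,\dots,E$ it draws, independently of everything else, a uniform permutation $\pi^e$ of $\{1,\dots,N\}$ and $\{S^e_{b,h}\}\leftarrow\mathrm{Sample}_{s,m}$. In round $b$ of epoch $e$ it computes $a_h=\mathcal A(w,\{\xi_{\pi^e(i)}\}_{i\in S^e_{b,h}})$ for $h=1,\dots,m$, where $\mathcal A$ is a (possibly randomized) algorithm and $w$ is the current local model, and then $$\bar U=\sum_{h=1}^m [a_h]_C+\mathcal N(0,(2C\sigma)^2 I),\qquad [x]_C=x/\max\{1,\|x\|/C\}.$$ It transmits $\bar U$ (up to the factor $1/m$) and updates $w\leftarrow w-\eta\,\bar U/m$, with a step size $\eta$ that may depend on the round. Before each call of $\mathcal A$ an interrupt service routine may replace $w$, depending on the coins and on past transmissions. The strong adversary observes all permutations, all sets $S^e_{b,h}$, all coins used by $\mathcal A$ and by the interrupts, and all $\bar U$; only the Gaussian noise is hidden. $\mathcal M(d)$ denotes the law of these observations. For $g\le N$ and a sample space with at least $N+g$ elements, $\mathcal M$ is *$h$-DP for groups of size $g$* if $h$ is a trade-off function and $T(\mathcal M(d),\mathcal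 M(d'))\ge h$ on $[0,1]$ for every measurable algorithm $\mathcal A$, for all data sets $d,d'$ of size $N$ with $\max\{|d\setminus d'|,|d'\setminus d|\}\le g$ and $N=|d\cap d'|+g$, and for all listings of $d$ and $d'$ that agree at every index that carries a sample of $d\cap d'$ in either of them. Let $\mathcal C=\{\sqrt{\sum_{k=1}^g c_kk^2}: c_k\in\mathbb N\}$ and, for $c\in\mathcal C$, $$q_E(c)=\Pr\Big[c^2=\sum_{k=1}^g c_kk^2\Big],\quad c_k=\#\{(b,e):L_{b,e}=k\},\quad L_{b,e}=|\{h:\pi^e(S^e_{b,h})\cap\{1,\dots,g\}\ne\emptyset\}|.$$ Let $c^{\tt U}>0$ and let $u\in[0,1]$ satisfy $u\ge\sum_{c\in\mathcal C,\,c<c^{\tt U}}q_E(c)$. Put $$\hat f^{\tt U}_{c^{\tt U}}(\alpha)=u+(1-u)G_{c^{\tt U}/\sigma}(\alpha),\qquad f^{\tt U}_{c^{\tt U}}=\min\{\hat f^{\tt U}_{c^{\tt U}},(\hat f^{\tt U}_{c^{\tt U}})^{-1}\}^{**}.$$ **Theorem.** If $\mathcal M$ is $h$-DP for groups of size $g$,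 then on $[0,1]$ $$h\le f^{\tt U}_{c^{\tt U}}\le\hat f^{\tt U}_{c^{\tt U}}.$$ Moreover $f^{\tt U}_{c^{\tt U}}$ is a symmetric trade-off function, and if $u<1$ then $$f^{\tt U}_{c^{\tt U}}(\alpha)=\begin{cases}u+(1-u)G_{c^{\tt U}/\sigma}(\alpha),&\alpha\in[0,\beta_0],\\ \beta_0+\beta_1-\alpha,&\alpha\in[\beta_0,\beta_1],\\ G_{c^{\tt U}/\sigma}\big(\tfrac{\alpha-u}{1-u}\big),&\alpha\in[\beta_1,1],\end{cases}$$ with $0\le\beta_0\le\beta_1\le1$ given by $$\beta_0=1-\Phi\Big(\tfrac{c^{\tt U}}{2\sigma}-\tfrac{\sigma}{c^{\tt U}}\ln(1-u)\Big),\quad \beta_1=u+(1-u)\Big(1-\Phi\Big(\tfrac{c^{\tt U}}{2\sigma}+\tfrac{\sigma}{c^{\tt U}}\ln(1-u)\Big)\Big).$$ If $u=1$ (the limit $\beta_0=0$, $\beta_1=1$) then $f^{\tt U}_{c^{\tt U}}(\alpha)=1-\alpha$. -/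

import Mathlib

open Set MeasureTheory ProbabilityTheory

noncomputable section

namespace DPSGD

/-! ### Trade-off functions -/

/-- The trade-off function `T(P,Q)(α) = inf_φ {β_φ : α_φ ≤ α}`, where `φ` ranges over the measurable
rejection rules with values in `[0,1]`, `α_φ = E_P[φ]` and `β_φ = 1 - E_Q[φ]`. -/
def tradeoff {O : Type*} [MeasurableSpace O] (P Q : Measure O) (α : ℝ) : ℝ :=
  sInf {β : ℝ | ∃ φ : O → ℝ, Measurable φ ∧ (∀ o, φ o ∈ Icc (0 : ℝ) 1) ∧
    ∫ o, φ o ∂P ≤ α ∧ β = 1 - ∫ o, φ o ∂Q}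

/-- `f` is a trade-off function on `[0,1]`. -/
structure IsTradeoff (f : ℝ → ℝ) : Prop where
  convex : ConvexOn ℝ (Icc 0 1) f
  continuous : ContinuousOn f (Icc 0 1)
  antitone : AntitoneOn f (Icc 0 1)
  nonneg : ∀ α ∈ Icc (0 : ℝ) 1, 0 ≤ f α
  le_one_sub : ∀ α ∈ Icc (0 : ℝ) 1, f α ≤ 1 - α

/-- The inverse `f⁻¹(α) = inf {t ∈ [0,1] : f t ≤ α}`. The infimum is taken in the ordered set
`[0,1]`, so that it equals `1` when no `t` qualifies. -/
def inverse (f : ℝ → ℝ) (α : ℝ) : ℝ :=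
  sInf {t : ℝ | t ∈ Icc (0 : ℝ) 1 ∧ (f t ≤ α ∨ t = 1)}

/-- The conjugate `f^*(y) = sup_x {y x - f x}` of a function `f` with domain `[0,1]`. -/
def conjugate (f : ℝ → ℝ) (y : ℝ) : ℝ := ⨆ x : Icc (0 : ℝ) 1, (y * x - f x)

/-- The double conjugate `f^**(x) = sup_y {x y - f^*(y)}` of a function `f` with domain `[0,1]`. -/
def biconjugate (f : ℝ → ℝ) (x : ℝ) : ℝ := ⨆ y : ℝ, (x * y - conjugate f y)

/-- The Gaussian trade-off function `G_μ = T(N(0,1), N(μ,1))`. -/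
def gaussianTradeoff (μ : ℝ) : ℝ → ℝ := tradeoff (gaussianReal 0 1) (gaussianReal μ 1)

/-- The standard normal cumulative distribution function. -/
def Phi (x : ℝ) : ℝ := cdf (gaussianReal 0 1) x

/-! ### The general algorithmic framework -/

/-- The space of models and updates, `ℝⁿ` with the Euclidean norm. -/
abbrev Model (n : ℕ) : Type := EuclideanSpace ℝ (Fin n)

/-- The clipping operation `[x]_C = x / max {1, ‖x‖ / C}`. -/
def clip {n : ℕ} (C : ℝ) (x : Model n) : Model n := (max 1 (‖x‖ / C))⁻¹ • x

/-- The sampling randomness of one epoch with `B` rounds: a permutation of the `N` indices and the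
index sets `S_{b,h}`, for the rounds `b` and the calls `h` within a round. -/
structure Draw (N B m : ℕ) where
  perm : Equiv.Perm (Fin N)
  sets : Fin B → Fin m → Finset (Fin N)

instance (N B m : ℕ) : MeasurableSpace (Draw N B m) := ⊤

/-- All parameters of the framework, except for the optimization algorithm that is run in the inner
loop. `Ω` is the space of coin values; every call in the inner loop has its own independent coin.
There are `B = N / (m s)` rounds per epoch, and the rounds of the whole run are numbered by
`Fin (E * B)`: round `τ` is round `τ.modNat` of epoch `τ.divNat`. -/
structure Framework (n : ℕ) (Ω : Type*) [MeasurableSpace Ω] where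
  /-- size of the index set that is sampled -/
  N : ℕ
  /-- number of epochs -/
  E : ℕ
  /-- size of each index set `S_{b,h}` -/
  s : ℕ
  /-- number of calls of the algorithm per round -/
  m : ℕ
  s_pos : 0 < s
  m_pos : 0 < m
  dvd : m * s ∣ N
  /-- clipping constant -/
  C : ℝ
  /-- noise parameter -/
  σ : ℝ
  C_pos : 0 < C
  σ_pos : 0 < σ
  /-- initial model -/
  w₀ : Model n
  /-- step sizes -/
  η : Fin (E * (N / (m * s))) → ℝ
  /-- the sampling procedure `Sample_{s,m}` -/
  sample : PMF (Fin (N / (m * s)) → Fin m → Finset (Fin N))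
  sample_card : ∀ S ∈ sample.support, ∀ b h, (S b h).card = s
  sample_disjoint : ∀ S ∈ sample.support, ∀ b, Pairwise fun h h' => Disjoint (S b h) (S b h')
  /-- law of the coin of one call -/
  coin : Measure Ω
  coin_prob : IsProbabilityMeasure coin
  /-- the interrupt service routine: the local model after the interrupts that precede a given call,
  as a function of the coins, the updates transmitted so far and the current local model (it is the
  current local model if no global model was received). -/
  isr : Fin (E * (N / (m * s))) × Fin m → (Fin (E * (N / (m * s))) × Fin m → Ω) →
    (Fin (E * (N / (m * s))) → Model n) → Model n → Model n
  isr_measurable : ∀ c, Measurable fun p : (Fin (E * (N / (m * s))) × Fin m → Ω) ×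
    (Fin (E * (N / (m * s))) → Model n) × Model n => isr c p.1 p.2.1 p.2.2

namespace Framework

variable {n : ℕ} {Ω : Type*} [MeasurableSpace Ω] (M : Framework n Ω)

/-- Number of rounds per epoch. -/
abbrev B : ℕ := M.N / (M.m * M.s)

/-- The rounds of the whole run. -/
abbrev Round : Type := Fin (M.E * M.B)

/-- The sampling randomness of the whole run. -/
abbrev Draws : Type := Fin M.E → Draw M.N M.B M.m

/-- The coins of the whole run. -/
abbrev Coins : Type _ := M.Round × Fin M.m → Ω

/-- Sequences of `n`-dimensional vectors, one for each round. -/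
abbrev Transcript : Type := M.Round → Model n

/-- Law of the sampling randomness of one epoch: the permutation is uniform, and the sampling
procedure is run independently of it. -/
def epochLaw : PMF (Draw M.N M.B M.m) :=
  (PMF.uniformOfFintype (Equiv.Perm (Fin M.N))).bind fun π => M.sample.map fun S => ⟨π, S⟩

/-- Law of the sampling randomness: the epochs are independent. -/
def drawLaw : Measure M.Draws := Measure.pi fun _ => M.epochLaw.toMeasure

/-- Law of the coins: the calls are independent. -/
def coinLaw : Measure M.Coins := Measure.pi fun _ => M.coin

/-- Law of the noise: independent `N(0, (2Cσ)² I)` vectors. -/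
def noiseLaw : Measure M.Transcript :=
  Measure.pi fun _ => (stdGaussian (Model n)).map fun z => (2 * M.C * M.σ) • z

section Run

/-! A run on the data set that is listed by `r`, with optimization algorithm `A`. The value
`A ω w Y` is the output of the algorithm with coin `ω`, local model `w` and set of samples `Y`. -/

variable {X : Type*} (A : Ω → Model n → Finset X → Model n) (r : Fin M.N ↪ X)
  (x : M.Draws) (ω : M.Coins) (z : M.Transcript)

/-- The set of samples that call `h` of round `τ` works on. -/
def batch (τ : M.Round) (h : Fin M.m) : Finset X :=
  (((x τ.divNat).sets τ.modNat h).map (x τ.divNat).perm.toEmbedding).map r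

/-- The local model in round `τ` just after the interrupts that precede the first `k` calls, when the
round starts with the model `w` and the past updates `past`. -/
def localModel (τ : M.Round) (past : M.Transcript) (w : Model n) : ℕ → Model n
  | 0 => w
  | k + 1 =>
    if hk : k < M.m then M.isr (τ, ⟨k, hk⟩) ω past (localModel τ past w k)
    else localModel τ past w k

/-- `U = ∑_h [a_h]_C`, where `a_h` is computed from the local model at the time of call `h`. -/
def update (τ : M.Round) (past : M.Transcript) (w : Model n) : Model n :=
  ∑ h : Fin M.m,
    clip M.C (A (ω (τ, h)) (M.localModel ω τ past w (h + 1)) (M.batch r x τ h))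

/-- The local model and the noisy updates `U + noise` after the first `t` rounds (updates of later
rounds are still `0`). -/
def run : ℕ → Model n × M.Transcript
  | 0 => (M.w₀, 0)
  | t + 1 =>
    if ht : t < M.E * M.B then
      let τ : M.Round := ⟨t, ht⟩
      let w := (run t).1
      let past := (run t).2
      let Ubar := M.update A r x ω τ past w + z τ
      (M.localModel ω τ past w M.m - (M.η τ / M.m) • Ubar, Function.update past τ Ubar)
    else run t

/-- What the strong adversary observes when the data set is listed by `r`: all the sampling
randomness, all the coins, and all the noisy updates. Only the Gaussian noise stays hidden. -/
def view : Measure (M.Draws × M.Coins × M.Transcript) :=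
  (M.drawLaw.prod (M.coinLaw.prod M.noiseLaw)).map fun p =>
    (p.1, p.2.1, (M.run A r p.1 p.2.1 p.2.2 (M.E * M.B)).2)

end Run

end Framework

/-! ### Differential privacy for groups of size `g` -/

open Classical in
/-- `d` and `d'` are data sets that differ in at most `g` samples on either side, with
`N = |d ∩ d'| + g`, and `r`, `r'` are neighboring listings of them by the same index set. -/
structure IsGroupPair {X : Type*} (g N : ℕ) (d d' : Finset X) (r r' : Fin N ↪ X) : Prop where
  sdiff_le : max (d \ d').card (d' \ d).card ≤ g
  card_eq : N = (d ∩ d').card + g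
  image_left : Finset.univ.map r = d
  image_right : Finset.univ.map r' = d'
  agree : ∀ i, (r i ∈ d ∩ d' ∨ r' i ∈ d ∩ d') → r i = r' i

/-- The framework is `f`-DP for groups of size `g` of samples in `X`, against the strong adversary,
whatever (measurable) optimization algorithm is run in its inner loop. -/
def IsGroupDP {n : ℕ} {Ω : Type*} [MeasurableSpace Ω] (M : Framework n Ω) (X : Type*) (g : ℕ)
    (f : ℝ → ℝ) : Prop :=
  IsTradeoff f ∧
    ∀ A : Ω → Model n → Finset X → Model n,
      (∀ Y, Measurable fun p : Ω × Model n => A p.1 p.2 Y) →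
      ∀ (d d' : Finset X) (r r' : Fin M.N ↪ X), IsGroupPair g M.N d d' r r' →
        ∀ α ∈ Icc (0 : ℝ) 1, f α ≤ tradeoff (M.view A r) (M.view A r') α

/-! ### The sampling induced distribution and the upper bound functions -/

namespace Framework

variable {n : ℕ} {Ω : Type*} [MeasurableSpace Ω] (M : Framework n Ω)

/-- `L_{b,e}`, the number of calls `h` in the round for which `π^e(S^e_{b,h})` meets the first `g`
indices. -/
def hits (g : ℕ) (x : M.Draws) (e : Fin M.E) (b : Fin M.B) : ℕ :=
  (Finset.univ.filter fun h : Fin M.m => ∃ i ∈ (x e).sets b h, ((x e).perm i : ℕ) < g).card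

/-- `c_k`, the number of rounds `(b,e)` with `L_{b,e} = k`. -/
def count (g : ℕ) (x : M.Draws) (k : ℕ) : ℕ :=
  (Finset.univ.filter fun p : Fin M.E × Fin M.B => M.hits g x p.1 p.2 = k).card

/-- The distribution `q_E(c)`, the probability that `c² = ∑_{k=1}^g c_k k²`. -/
def q (g : ℕ) (c : ℝ) : ENNReal :=
  M.drawLaw {x | c ^ 2 = ∑ k ∈ Finset.Icc 1 g, (M.count g x k : ℝ) * (k : ℝ) ^ 2}

end Framework

/-- The set `𝒞` of all `√(∑_{k=1}^g c_k k²)` with natural numbers `c_k`. -/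
def cSet (g : ℕ) : Set ℝ :=
  {c | ∃ a : ℕ → ℕ, c = √(∑ k ∈ Finset.Icc 1 g, (a k : ℝ) * (k : ℝ) ^ 2)}

/-- `f̂^U_c(α) = u + (1 - u) G_{c/σ}(α)`. -/
def fHatU (σ c u α : ℝ) : ℝ := u + (1 - u) * gaussianTradeoff (c / σ) α

/-- `f^U_c = min {f̂^U_c, (f̂^U_c)⁻¹}^**`. -/
def fU (σ c u : ℝ) : ℝ → ℝ :=
  biconjugate fun α => min (fHatU σ c u α) (inverse (fHatU σ c u) α)

/-- The left breakpoint. -/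
def beta0 (σ c u : ℝ) : ℝ := 1 - Phi (c / (2 * σ) - σ / c * Real.log (1 - u))

/-- The right breakpoint. -/
def beta1 (σ c u : ℝ) : ℝ :=
  u + (1 - u) * (1 - Phi (c / (2 * σ) + σ / c * Real.log (1 - u)))

end DPSGD

end

open DPSGD

noncomputable section

namespace DPSGD

/-! ### The standard normal distribution function -/

/-! The bound on `h` comes from one bad instance. Take two listings that differ exactly in the first
`g` indices, and let the inner algorithm return `C e` or `-C e`, for a unit vector `e`, when it sees
a distinguishing sample, and `0` otherwise. The update of a round is then `±L C e`, whatever the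
model and the interrupts do, so for known sampling randomness the adversary tests two Gaussian
sequences whose means are opposite. The normalized projection of the transcript onto the difference
of the means is a unit normal whose mean shifts by `√(∑ L²) / σ`. Rejecting only when `√(∑ c_k k²)`
is at least `c`, with a threshold adapted to the draw, keeps the first error at most `α`. The second
error is at most `1` on an event of probability at most `u`, and at most `G_{c/σ}(α)` off it. This
is `Framework.exists_test`. Exchanging the two data sets and complementing the test gives the bound
by the inverse (`IsGroupDP.le_fHatU_and_le_inverse`).

The analytic part determines `fU` by supporting lines. By Neyman-Pearson the supporting lines of
`G_μ` have explicit intercepts `gaussInf μ k`, which are concave in `k`. Concavity and the symmetry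
of `G_μ` yield `mix_gaussInf_le`: for `b ≥ 1`, the supporting line of the mixture with slope `-b`
also lies below its inverse. Hence the tangents of slope at most `-1` force `fU` to equal the
mixture up to `β₀`, their reflections force it to equal the inverse from `β₁` on, and the line of
slope `-1` touches at both breakpoints and fills the gap. The resulting function is a convex
involution of `[0,1]`, so it is a symmetric trade-off function. A convex function below the mixture
and below its inverse lies below `fU`: outside `[β₀, β₁]` directly, and inside by comparison with
the chord (`le_fU`). -/

lemma Phi_eq (x : ℝ) : Phi x = (gaussianReal 0 1).real (Iic x) := cdf_eq_real _ x

lemma Phi_mono : Monotone Phi := monotone_cdf _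

lemma Phi_nonneg (x : ℝ) : 0 ≤ Phi x := cdf_nonneg _ x

lemma Phi_le_one (x : ℝ) : Phi x ≤ 1 := cdf_le_one _ x

lemma tendsto_Phi_atTop : Filter.Tendsto Phi Filter.atTop (nhds 1) := tendsto_cdf_atTop _

lemma tendsto_Phi_atBot : Filter.Tendsto Phi Filter.atBot (nhds 0) := tendsto_cdf_atBot _

lemma continuous_Phi : Continuous Phi := by
  rw [continuous_iff_continuousAt]
  intro x
  have : ContinuousAt (cdf (gaussianReal 0 1)) x := by
    rw [(monotone_cdf _).continuousAt_iff_leftLim_eq_rightLim, StieltjesFunction.rightLim_eq]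
    have h := (cdf (gaussianReal 0 1)).measure_singleton x
    have : NullSingletonClass (gaussianReal 0 1) := nullSingletonClass_gaussianReal one_ne_zero
    rw [measure_cdf, measure_singleton, eq_comm, ENNReal.ofReal_eq_zero] at h
    exact le_antisymm ((monotone_cdf _).leftLim_le le_rfl) (by linarith)
  exact this

lemma exists_Phi_eq {p : ℝ} (h0 : 0 < p) (h1 : p < 1) : ∃ t, Phi t = p :=
  mem_range_of_exists_le_of_exists_ge continuous_Phi
    ((tendsto_Phi_atBot.eventually (gt_mem_nhds h0)).exists.imp fun _ => le_of_lt)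
    ((tendsto_Phi_atTop.eventually (lt_mem_nhds h1)).exists.imp fun _ => le_of_lt)

lemma gaussianReal_real_Iic (μ t : ℝ) : (gaussianReal μ 1).real (Iic t) = Phi (t - μ) := by
  rw [Phi_eq, ← sub_self μ, ← gaussianReal_map_sub_const, map_measureReal_apply (by fun_prop)
    measurableSet_Iic]
  congr 1
  ext x
  simp

lemma gaussianReal_real_Ioi (μ t : ℝ) : (gaussianReal μ 1).real (Ioi t) = 1 - Phi (t - μ) := by
  rw [← compl_Iic, probReal_compl_eq_one_sub measurableSet_Iic, gaussianReal_real_Iic]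

lemma Phi_neg (x : ℝ) : Phi (-x) = 1 - Phi x := by
  have : NullSingletonClass (gaussianReal 0 1) := nullSingletonClass_gaussianReal one_ne_zero
  have h : (gaussianReal 0 1).map (fun y => -y) = gaussianReal 0 1 := by
    rw [gaussianReal_map_neg, neg_zero]
  have h' := gaussianReal_real_Ioi 0 x
  rw [sub_zero] at h'
  rw [← h', Phi_eq]
  nth_rw 1 [← h]
  rw [map_measureReal_apply measurable_neg measurableSet_Iic, measureReal_congr Ioi_ae_eq_Ici]
  congr 1
  ext y
  simp

/-! ### The Neyman-Pearson lemma for two unit-variance normal distributions -/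

lemma gaussianPDFReal_eq_exp_mul (μ x : ℝ) :
    gaussianPDFReal μ 1 x = Real.exp (μ * x - μ ^ 2 / 2) * gaussianPDFReal 0 1 x := by
  simp only [gaussianPDFReal_def, NNReal.coe_one, mul_one, sub_zero]
  rw [mul_left_comm, ← Real.exp_add]
  ring_nf

lemma integrable_of_mem_Icc {O : Type*} [MeasurableSpace O] (P : Measure O) [IsFiniteMeasure P]
    {φ : O → ℝ} (hφ : Measurable φ) (h01 : ∀ x, φ x ∈ Icc (0 : ℝ) 1) : Integrable φ P :=
  Integrable.of_bound hφ.aestronglyMeasurable 1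
    (.of_forall fun x => by
      rw [Real.norm_eq_abs, abs_le]; constructor <;> linarith [(h01 x).1, (h01 x).2])

lemma neyman_pearson {μ : ℝ} (hμ : 0 < μ) (t : ℝ) {φ : ℝ → ℝ} (hφ : Measurable φ)
    (h01 : ∀ x, φ x ∈ Icc (0 : ℝ) 1) :
    Phi (t - μ) + Real.exp (μ * t - μ ^ 2 / 2) * (1 - Phi t) ≤
      1 - ∫ x, φ x ∂gaussianReal μ 1 +
        Real.exp (μ * t - μ ^ 2 / 2) * ∫ x, φ x ∂gaussianReal 0 1 := by
  -- The likelihood ratio of the two densities at the threshold `t`.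
  set k := Real.exp (μ * t - μ ^ 2 / 2)
  have key : ∀ ψ : ℝ → ℝ, Measurable ψ → (∀ x, ψ x ∈ Icc (0 : ℝ) 1) →
      Integrable (fun x => (gaussianPDFReal μ 1 x - k * gaussianPDFReal 0 1 x) * ψ x) ∧
      ∫ x, ψ x ∂gaussianReal μ 1 - k * ∫ x, ψ x ∂gaussianReal 0 1 =
        ∫ x, (gaussianPDFReal μ 1 x - k * gaussianPDFReal 0 1 x) * ψ x := by
    intro ψ hψ h01
    have hi : ∀ ν, Integrable fun x => gaussianPDFReal ν 1 x * ψ x := fun ν =>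
      (integrable_gaussianPDFReal ν 1).mul_bdd (c := 1) hψ.aestronglyMeasurable
        (.of_forall fun x => by
          rw [Real.norm_eq_abs, abs_le]; constructor <;> linarith [(h01 x).1, (h01 x).2])
    have he : (fun x => (gaussianPDFReal μ 1 x - k * gaussianPDFReal 0 1 x) * ψ x) =
        fun x => gaussianPDFReal μ 1 x * ψ x - k * (gaussianPDFReal 0 1 x * ψ x) := by
      ext x; ring
    rw [he]
    refine ⟨(hi μ).sub ((hi 0).const_mul k), ?_⟩
    rw [integral_sub (hi μ) ((hi 0).const_mul k), integral_const_mul,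
      integral_gaussianReal_eq_integral_smul one_ne_zero,
      integral_gaussianReal_eq_integral_smul one_ne_zero]
    rfl
  have hm : Measurable ((Ioi t).indicator (1 : ℝ → ℝ)) := measurable_one.indicator measurableSet_Ioi
  have h1 : ∀ x, (Ioi t).indicator (1 : ℝ → ℝ) x ∈ Icc (0 : ℝ) 1 := fun x => by
    by_cases hx : x ∈ Ioi t <;> simp [hx]
  obtain ⟨i1, e1⟩ := key _ hφ h01
  obtain ⟨i2, e2⟩ := key _ hm h1
  -- The difference `q - k p` of the densities is nonnegative beyond `t` and nonpositive before it,
  -- so the indicator of `Ioi t` maximizes the integrand pointwise.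
  have hle := integral_mono i1 i2 fun x => by
    have hp := gaussianPDFReal_nonneg 0 1 x
    have hq := gaussianPDFReal_eq_exp_mul μ x
    dsimp only
    by_cases hx : x ∈ Ioi t
    · have : k ≤ Real.exp (μ * x - μ ^ 2 / 2) := Real.exp_le_exp.2 (by nlinarith [mem_Ioi.1 hx])
      simp only [indicator_of_mem hx, Pi.one_apply]
      have := mul_le_mul_of_nonneg_right this hp
      exact mul_le_mul_of_nonneg_left (h01 x).2 (by linarith)
    · have : Real.exp (μ * x - μ ^ 2 / 2) ≤ k :=
        Real.exp_le_exp.2 (by nlinarith [not_lt.1 (mem_Ioi.not.1 hx)])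
      simp only [indicator_of_notMem hx]
      have := mul_le_mul_of_nonneg_right this hp
      rw [mul_zero]
      exact mul_nonpos_of_nonpos_of_nonneg (by linarith) (h01 x).1
  rw [← e1, ← e2, integral_indicator_one measurableSet_Ioi, integral_indicator_one measurableSet_Ioi,
    gaussianReal_real_Ioi, gaussianReal_real_Ioi, sub_zero] at hle
  linarith

/-! ### General facts on `T(P, Q)` -/

section Tradeoff

variable {O : Type*} [MeasurableSpace O] (P Q : Measure O)

lemma tradeoff_le [IsProbabilityMeasure Q] {α : ℝ} {φ : O → ℝ} (hφ : Measurable φ)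
    (h01 : ∀ o, φ o ∈ Icc (0 : ℝ) 1) (hα : ∫ o, φ o ∂P ≤ α) :
    tradeoff P Q α ≤ 1 - ∫ o, φ o ∂Q := by
  refine csInf_le ⟨0, ?_⟩ ⟨φ, hφ, h01, hα, rfl⟩
  rintro _ ⟨ψ, hψ, h, -, rfl⟩
  have := integral_mono (integrable_of_mem_Icc Q hψ h) (integrable_const 1) fun x => (h x).2
  simp at this
  linarith

lemma le_tradeoff {α a : ℝ} (hα : 0 ≤ α) (h : ∀ φ : O → ℝ, Measurable φ →
    (∀ o, φ o ∈ Icc (0 : ℝ) 1) → ∫ o, φ o ∂P ≤ α → a ≤ 1 - ∫ o, φ o ∂Q) :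
    a ≤ tradeoff P Q α := by
  refine le_csInf ⟨1 - ∫ _, (0 : ℝ) ∂Q, fun _ => 0, measurable_const, by simp, by simpa, rfl⟩ ?_
  rintro _ ⟨φ, hφ, h01, h1, rfl⟩
  exact h φ hφ h01 h1

lemma tradeoff_nonneg [IsProbabilityMeasure Q] {α : ℝ} (hα : 0 ≤ α) : 0 ≤ tradeoff P Q α :=
  le_tradeoff P Q hα fun φ hφ h01 _ => by
    have := integral_mono (integrable_of_mem_Icc Q hφ h01) (integrable_const 1) fun x => (h01 x).2
    simp at this
    linarith

lemma tradeoff_le_one_sub [IsProbabilityMeasure P] [IsProbabilityMeasure Q] {α : ℝ}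
    (hα : α ∈ Icc (0 : ℝ) 1) : tradeoff P Q α ≤ 1 - α := by
  simpa using tradeoff_le P Q (φ := fun _ => α) measurable_const (fun _ => hα) (by simp)

end Tradeoff

/-! ### The Gaussian trade-off function -/

section Gaussian

variable {μ : ℝ}

lemma gaussianTradeoff_ge_line (hμ : 0 < μ) (t : ℝ) {x : ℝ} (hx : 0 ≤ x) :
    Phi (t - μ) + Real.exp (μ * t - μ ^ 2 / 2) * (1 - Phi t - x) ≤ gaussianTradeoff μ x := by
  refine le_tradeoff _ _ hx fun φ hφ h01 h => ?_
  have h1 := neyman_pearson hμ t hφ h01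
  have h2 := mul_le_mul_of_nonneg_left h (Real.exp_pos (μ * t - μ ^ 2 / 2)).le
  linarith

lemma gaussianTradeoff_one_sub_Phi (hμ : 0 < μ) (t : ℝ) :
    gaussianTradeoff μ (1 - Phi t) = Phi (t - μ) := by
  refine le_antisymm ?_ (by simpa using gaussianTradeoff_ge_line hμ t (sub_nonneg.2 (Phi_le_one t)))
  have hm : Measurable ((Ioi t).indicator (1 : ℝ → ℝ)) := measurable_one.indicator measurableSet_Ioi
  have h1 : ∀ x, (Ioi t).indicator (1 : ℝ → ℝ) x ∈ Icc (0 : ℝ) 1 := fun x => by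
    by_cases hx : x ∈ Ioi t <;> simp [hx]
  have h := tradeoff_le (gaussianReal 0 1) (gaussianReal μ 1) (α := 1 - Phi t) hm h1
    (by rw [integral_indicator_one measurableSet_Ioi, gaussianReal_real_Ioi, sub_zero])
  rw [integral_indicator_one measurableSet_Ioi, gaussianReal_real_Ioi, sub_sub_cancel] at h
  exact h

lemma gaussianTradeoff_nonneg {x : ℝ} (hx : 0 ≤ x) : 0 ≤ gaussianTradeoff μ x :=
  tradeoff_nonneg _ _ hx

lemma gaussianTradeoff_le {x : ℝ} (hx : x ∈ Icc (0 : ℝ) 1) : gaussianTradeoff μ x ≤ 1 - x :=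
  tradeoff_le_one_sub _ _ hx

lemma gaussianTradeoff_zero (hμ : 0 < μ) : gaussianTradeoff μ 0 = 1 := by
  refine le_antisymm (by simpa using gaussianTradeoff_le (μ := μ) (x := 0) (by simp)) ?_
  have h : Filter.Tendsto (fun t => Phi (t - μ)) Filter.atTop (nhds 1) :=
    tendsto_Phi_atTop.comp (Filter.tendsto_atTop_add_const_right _ _ Filter.tendsto_id)
  -- Level `0` is attained by no finite threshold, so the threshold is sent to infinity.
  refine le_of_tendsto h (.of_forall fun t => ?_)
  have h1 := gaussianTradeoff_ge_line hμ t le_rfl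
  have h2 := mul_nonneg (Real.exp_pos (μ * t - μ ^ 2 / 2)).le (sub_nonneg.2 (Phi_le_one t))
  linarith

lemma gaussianTradeoff_one : gaussianTradeoff μ 1 = 0 :=
  le_antisymm (by simpa using gaussianTradeoff_le (μ := μ) (x := 1) (by simp))
    (gaussianTradeoff_nonneg zero_le_one)

/-- The reflection `Phi_neg` carries the point of the curve with threshold `t` to the one with
threshold `μ - t`. -/
lemma gaussianTradeoff_gaussianTradeoff (hμ : 0 < μ) {x : ℝ} (hx : x ∈ Icc (0 : ℝ) 1) :
    gaussianTradeoff μ (gaussianTradeoff μ x) = x := by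
  rcases hx.1.eq_or_lt with rfl | h0
  · rw [gaussianTradeoff_zero hμ, gaussianTradeoff_one]
  rcases hx.2.eq_or_lt with rfl | h1
  · rw [gaussianTradeoff_one, gaussianTradeoff_zero hμ]
  obtain ⟨t, ht⟩ := exists_Phi_eq (p := 1 - x) (by linarith) (by linarith)
  have : x = 1 - Phi t := by linarith
  rw [this, gaussianTradeoff_one_sub_Phi hμ, show t - μ = -(μ - t) by ring, Phi_neg,
    gaussianTradeoff_one_sub_Phi hμ, show μ - t - μ = -t by ring, Phi_neg]

end Gaussian

lemma tradeoff_anti {O : Type*} [MeasurableSpace O] (P Q : Measure O) [IsProbabilityMeasure Q]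
    {x y : ℝ} (hx : 0 ≤ x) (hxy : x ≤ y) : tradeoff P Q y ≤ tradeoff P Q x :=
  le_tradeoff P Q hx fun _ hφ h01 h => tradeoff_le P Q hφ h01 (h.trans hxy)

/-! ### Supporting lines of the Gaussian trade-off function -/

/-- The minimum of `G_μ x + k x`, in closed form. -/
def gaussInf (μ k : ℝ) : ℝ :=
  Phi (Real.log k / μ - μ / 2) + k * (1 - Phi (Real.log k / μ + μ / 2))

section GaussInf

variable {μ : ℝ}

lemma gaussInf_exp (hμ : 0 < μ) (t : ℝ) : gaussInf μ (Real.exp (μ * t - μ ^ 2 / 2)) =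
    Phi (t - μ) + Real.exp (μ * t - μ ^ 2 / 2) * (1 - Phi t) := by
  have h1 : (μ * t - μ ^ 2 / 2) / μ - μ / 2 = t - μ := by field_simp; ring
  have h2 : (μ * t - μ ^ 2 / 2) / μ + μ / 2 = t := by field_simp; ring
  rw [gaussInf, Real.log_exp, h1, h2]

lemma exists_exp_eq (hμ : 0 < μ) {k : ℝ} (hk : 0 < k) :
    ∃ t, k = Real.exp (μ * t - μ ^ 2 / 2) := by
  refine ⟨Real.log k / μ + μ / 2, ?_⟩
  rw [show μ * (Real.log k / μ + μ / 2) - μ ^ 2 / 2 = Real.log k by field_simp; ring,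
    Real.exp_log hk]

lemma gaussInf_sub_le (hμ : 0 < μ) {k x : ℝ} (hk : 0 < k) (hx : 0 ≤ x) :
    gaussInf μ k - k * x ≤ gaussianTradeoff μ x := by
  obtain ⟨t, rfl⟩ := exists_exp_eq hμ hk
  rw [gaussInf_exp hμ]
  have := gaussianTradeoff_ge_line hμ t hx
  linarith

/-- Reflecting the symmetric graph of `G_μ` in the diagonal turns a supporting line of slope `-1/k`
into one of slope `-k`, and multiplies its intercept by `k`. -/
lemma gaussInf_eq_mul_inv {k : ℝ} (hk : 0 < k) : gaussInf μ k = k * gaussInf μ k⁻¹ := by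
  rw [gaussInf, gaussInf, Real.log_inv,
    show -Real.log k / μ - μ / 2 = -(Real.log k / μ + μ / 2) by ring,
    show -Real.log k / μ + μ / 2 = -(Real.log k / μ - μ / 2) by ring, Phi_neg, Phi_neg]
  field_simp
  ring

/-- As an infimum of the affine functions `k ↦ G_μ x + k x`, the intercept has the minimizing `x = 1
- Φ(t)` as a supergradient; it lies in `[0,1]`. -/
lemma exists_supergradient_gaussInf (hμ : 0 < μ) {k : ℝ} (hk : 0 < k) :
    ∃ p ∈ Icc (0 : ℝ) 1, ∀ k', 0 < k' → gaussInf μ k' ≤ gaussInf μ k + (k' - k) * p := by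
  obtain ⟨t, rfl⟩ := exists_exp_eq hμ hk
  refine ⟨1 - Phi t, ⟨by linarith [Phi_le_one t], by linarith [Phi_nonneg t]⟩, fun k' hk' => ?_⟩
  have h := gaussInf_sub_le hμ hk' (sub_nonneg.2 (Phi_le_one t))
  rw [gaussianTradeoff_one_sub_Phi hμ] at h
  rw [gaussInf_exp hμ]
  linarith

lemma concaveOn_gaussInf (hμ : 0 < μ) : ConcaveOn ℝ (Ioi 0) (gaussInf μ) := by
  refine ⟨convex_Ioi 0, fun x hx y hy a b ha hb hab => ?_⟩
  obtain ⟨p, -, hp⟩ := exists_supergradient_gaussInf hμ ((convex_Ioi 0) hx hy ha hb hab)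
  have h1 := mul_le_mul_of_nonneg_left (hp x hx) ha
  have h2 := mul_le_mul_of_nonneg_left (hp y hy) hb
  simp only [smul_eq_mul] at *
  obtain rfl : b = 1 - a := by linarith
  linarith

/-- Write `I` for `gaussInf μ`. By the reflection identity the claim reads `v I(b/v) - I(bv) ≤
(b-1)(1-v)`. If `l` is the secant slope of `I` over `[1/v, b/v]`, then `v I(b/v) = I(v) + l(b-1)`,
while concavity gives `I(bv) ≥ I(v) + l(b-1)v`. The difference is at most `l(b-1)(1-v)`, and `l ≤ 1`
because supergradients are at most `1`. -/
lemma mix_gaussInf_le (hμ : 0 < μ) {v b : ℝ} (hv : 0 < v) (hv1 : v ≤ 1) (hb : 1 ≤ b) :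
    1 - v + v * gaussInf μ (b / v) ≤ b * (1 - v + v * gaussInf μ (b⁻¹ / v)) := by
  have hb0 : 0 < b := by linarith
  have hs : b * (v * gaussInf μ (b⁻¹ / v)) = gaussInf μ (b * v) := by
    rw [gaussInf_eq_mul_inv (μ := μ) (mul_pos hb0 hv), mul_inv, div_eq_mul_inv, mul_assoc]
  have hs1 : v * gaussInf μ v⁻¹ = gaussInf μ v := (gaussInf_eq_mul_inv hv).symm
  rcases hb.eq_or_lt with rfl | hb1
  · rw [inv_one]; linarith
  rcases hv1.eq_or_lt with rfl | hv1
  · simp only [mul_one, one_mul, sub_self, div_one, zero_add] at hs ⊢; exact hs.ge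
  have hconv : ConvexOn ℝ (Ioi 0) fun k => -gaussInf μ k := (concaveOn_gaussInf hμ).neg
  have hvi : v < v⁻¹ := hv1.trans (one_lt_inv₀ hv |>.2 hv1)
  have hbv : v < b * v := lt_mul_of_one_lt_left hv hb1
  have hbi : v⁻¹ < b / v := by rw [inv_eq_one_div]; gcongr
  have hbb : b * v ≤ b / v := by
    rw [div_eq_mul_inv]; gcongr
  have m0 : b * v ∈ Ioi (0 : ℝ) := mul_pos hb0 hv
  have m1 : b / v ∈ Ioi (0 : ℝ) := div_pos hb0 hv
  have m2 : v⁻¹ ∈ Ioi (0 : ℝ) := inv_pos.2 hv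
  -- The two secant comparisons pass through the secant over `[v, b/v]`; this works however `b v`
  -- and `v⁻¹` are ordered.
  have s1 := hconv.secant_mono (a := v) hv m0 m1 hbv.ne' (hvi.trans hbi).ne' hbb
  have s2 := hconv.secant_mono (a := b / v) m1 hv m2 (hvi.trans hbi).ne hbi.ne hvi.le
  obtain ⟨p, ⟨hp0, hp1⟩, hp⟩ := exists_supergradient_gaussInf hμ m2
  have h3 := hp _ m1
  have e1 : b * v - v = (b - 1) * v := by ring
  have e2 : b / v - v⁻¹ = (b - 1) * v⁻¹ := by field_simp
  set l := (gaussInf μ (b / v) - gaussInf μ v⁻¹) / ((b - 1) * v⁻¹) with hl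
  have hb1' : 0 < b - 1 := by linarith
  have hvi0 : 0 < v⁻¹ := inv_pos.2 hv
  have hl1 : l ≤ 1 := by
    rw [hl, div_le_one (mul_pos hb1' hvi0)]
    rw [e2] at h3
    have := mul_le_mul_of_nonneg_left hp1 (mul_pos hb1' hvi0).le
    linarith
  have hl2 : l * ((b - 1) * v) ≤ gaussInf μ (b * v) - gaussInf μ v := by
    rw [← le_div_iff₀ (mul_pos hb1' hv)]
    have t1 : (-gaussInf μ v⁻¹ - -gaussInf μ (b / v)) / (v⁻¹ - b / v) = -l := by
      rw [hl, ← e2, ← neg_sub (b / v) v⁻¹, div_neg]; ring_nf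
    have t2 : (-gaussInf μ v - -gaussInf μ (b / v)) / (v - b / v) =
        (-gaussInf μ (b / v) - -gaussInf μ v) / (b / v - v) := by
      rw [← neg_div_neg_eq, neg_sub, neg_sub]
    have t3 : (-gaussInf μ (b * v) - -gaussInf μ v) / (b * v - v) =
        -((gaussInf μ (b * v) - gaussInf μ v) / ((b - 1) * v)) := by
      rw [e1, ← neg_div]; ring_nf
    rw [t1, t2] at s2
    rw [t3] at s1
    linarith
  have hl3 : gaussInf μ (b / v) - gaussInf μ v⁻¹ = l * ((b - 1) * v⁻¹) := by
    rw [hl, div_mul_cancel₀ _ (mul_pos hb1' hvi0).ne']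
  have hl4 : v * gaussInf μ (b / v) - gaussInf μ v = l * (b - 1) := by
    rw [← hs1, ← mul_sub, hl3]; field_simp
  have hf := mul_nonneg (mul_nonneg hb1'.le (sub_nonneg.2 hl1)) (sub_nonneg.2 hv1.le)
  rw [mul_add, hs]
  nlinarith

end GaussInf

/-! ### Double conjugates -/

section Biconjugate

variable {f : ℝ → ℝ}

/-- Values in `[0,1]` make the family bounded, so the real supremum is genuine and not the default
`0`. -/
lemma sub_le_conjugate (hf : ∀ x ∈ Icc (0 : ℝ) 1, f x ∈ Icc (0 : ℝ) 1)
    (y : ℝ) {x : ℝ} (hx : x ∈ Icc (0 : ℝ) 1) : y * x - f x ≤ conjugate f y := by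
  refine le_ciSup (f := fun x : Icc (0 : ℝ) 1 => y * x - f x) ⟨|y|, ?_⟩ ⟨x, hx⟩
  rintro _ ⟨z, rfl⟩
  have h1 := (hf z z.2).1
  have h2 := mul_le_mul (le_abs_self y) z.2.2 z.2.1 (abs_nonneg y)
  dsimp only
  linarith

lemma biconjugate_le (hf : ∀ x ∈ Icc (0 : ℝ) 1, f x ∈ Icc (0 : ℝ) 1)
    {x : ℝ} (hx : x ∈ Icc (0 : ℝ) 1) : biconjugate f x ≤ f x :=
  ciSup_le fun y => by linarith [sub_le_conjugate hf y hx]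

lemma sub_conjugate_le_biconjugate (hf : ∀ x ∈ Icc (0 : ℝ) 1, f x ∈ Icc (0 : ℝ) 1)
    (y : ℝ) {x : ℝ} (hx : x ∈ Icc (0 : ℝ) 1) :
    x * y - conjugate f y ≤ biconjugate f x := by
  refine le_ciSup (f := fun y => x * y - conjugate f y) ⟨f x, ?_⟩ y
  rintro _ ⟨z, rfl⟩
  dsimp only
  linarith [sub_le_conjugate hf z hx]

/-- An affine minorant bounds the conjugate at its slope by minus its intercept. All lower bounds on
`fU` come from this. -/
lemma line_le_biconjugate (hf : ∀ x ∈ Icc (0 : ℝ) 1, f x ∈ Icc (0 : ℝ) 1)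
    {a y : ℝ} (h : ∀ x ∈ Icc (0 : ℝ) 1, a + y * x ≤ f x) {x : ℝ}
    (hx : x ∈ Icc (0 : ℝ) 1) : a + y * x ≤ biconjugate f x := by
  have : conjugate f y ≤ -a := ciSup_le fun z => by linarith [h z z.2]
  linarith [sub_conjugate_le_biconjugate hf y hx]

lemma convexOn_biconjugate (hf : ∀ x ∈ Icc (0 : ℝ) 1, f x ∈ Icc (0 : ℝ) 1) :
    ConvexOn ℝ (Icc 0 1) (biconjugate f) := by
  refine ⟨convex_Icc 0 1, fun x hx y hy a b ha hb hab => ciSup_le fun z => ?_⟩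
  have h1 := mul_le_mul_of_nonneg_left (sub_conjugate_le_biconjugate hf z hx) ha
  have h2 := mul_le_mul_of_nonneg_left (sub_conjugate_le_biconjugate hf z hy) hb
  simp only [smul_eq_mul]
  obtain rfl : b = 1 - a := by linarith
  linarith

end Biconjugate

/-! ### Inverses -/

lemma inverse_mem_Icc (f : ℝ → ℝ) (α : ℝ) : inverse f α ∈ Icc (0 : ℝ) 1 :=
  ⟨le_csInf ⟨1, by simp⟩ fun _ ht => ht.1.1, csInf_le ⟨0, fun _ ht => ht.1.1⟩ (by simp)⟩

lemma inverse_le {f : ℝ → ℝ} {α t : ℝ} (ht : t ∈ Icc (0 : ℝ) 1) (h : f t ≤ α) :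
    inverse f α ≤ t :=
  csInf_le ⟨0, fun _ ht => ht.1.1⟩ ⟨ht, .inl h⟩

lemma le_inverse {f : ℝ → ℝ} {α a : ℝ} (h1 : a ≤ 1)
    (h : ∀ t ∈ Icc (0 : ℝ) 1, f t ≤ α → a ≤ t) : a ≤ inverse f α := by
  refine le_csInf ⟨1, by simp⟩ ?_
  rintro t ⟨ht, h' | rfl⟩
  exacts [h t ht h', h1]

/-! ### Convex involutions of the unit interval -/

section Involution

variable {F : ℝ → ℝ}

lemma le_one_sub_of_convexOn (hc : ConvexOn ℝ (Icc 0 1) F) (hF0 : F 0 ≤ 1) (hF1 : F 1 ≤ 0)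
    {x : ℝ} (hx : x ∈ Icc (0 : ℝ) 1) : F x ≤ 1 - x := by
  have h := hc.2 (x := 0) (y := 1) (by simp) (by simp) (sub_nonneg.2 hx.2) hx.1 (by ring)
  simp only [smul_eq_mul, mul_zero, mul_one, zero_add] at h
  have h2 := mul_le_mul_of_nonneg_left hF0 (sub_nonneg.2 hx.2)
  have h3 := mul_le_mul_of_nonneg_left hF1 hx.1
  linarith

lemma antitoneOn_of_convexOn (hc : ConvexOn ℝ (Icc 0 1) F)
    (h0 : ∀ x ∈ Icc (0 : ℝ) 1, 0 ≤ F x) (hF1 : F 1 ≤ 0) : AntitoneOn F (Icc 0 1) := by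
  intro x hx y hy hxy
  rcases hxy.eq_or_lt with rfl | hlt
  · rfl
  have hx1 : 0 < 1 - x := by linarith [hy.2]
  -- The weight that writes `y` as a convex combination of `x` and `1`.
  have hle : (y - x) / (1 - x) ≤ 1 := (div_le_one hx1).2 (by linarith [hy.2])
  have hnn : 0 ≤ (y - x) / (1 - x) := div_nonneg (by linarith) hx1.le
  have h := hc.2 hx (y := 1) (by simp) (sub_nonneg.2 hle) hnn (by ring)
  have he : (1 - (y - x) / (1 - x)) * x + (y - x) / (1 - x) * 1 = y := by field_simp; ring
  simp only [smul_eq_mul] at h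
  rw [he] at h
  have h2 := mul_le_mul_of_nonneg_left hF1 hnn
  have h3 := mul_nonneg hnn (h0 x hx)
  linarith

/-- Continuity needs no estimate: an involution is surjective onto `[0,1]`, and a surjective
monotone map into the order dual is continuous. -/
lemma isTradeoff_of_involution (hc : ConvexOn ℝ (Icc 0 1) F)
    (h0 : ∀ x ∈ Icc (0 : ℝ) 1, 0 ≤ F x) (hF0 : F 0 ≤ 1) (hF1 : F 1 ≤ 0)
    (hFF : ∀ x ∈ Icc (0 : ℝ) 1, F (F x) = x) : IsTradeoff F := by
  have hm : ∀ x ∈ Icc (0 : ℝ) 1, F x ∈ Icc (0 : ℝ) 1 := fun x hx =>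
    ⟨h0 x hx, by linarith [le_one_sub_of_convexOn hc hF0 hF1 hx, hx.1]⟩
  have ha := antitoneOn_of_convexOn hc h0 hF1
  refine ⟨hc, ?_, ha, h0, fun x hx => le_one_sub_of_convexOn hc hF0 hF1 hx⟩
  let k : Icc (0 : ℝ) 1 → (Icc (0 : ℝ) 1)ᵒᵈ := fun x => OrderDual.toDual ⟨F x, hm x x.2⟩
  have hk : Monotone k := fun x y hxy => ha x.2 y.2 hxy
  have hs : Function.Surjective k := fun y =>
    ⟨⟨F (OrderDual.ofDual y).1, hm _ (OrderDual.ofDual y).2⟩,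
      congrArg OrderDual.toDual (Subtype.ext (hFF _ (OrderDual.ofDual y).2))⟩
  rw [continuousOn_iff_continuous_domRestrict]
  exact continuous_subtype_val.comp (continuous_ofDual.comp (hk.continuous_of_surjective hs))

lemma inverse_eq_of_involution (hc : ConvexOn ℝ (Icc 0 1) F)
    (h0 : ∀ x ∈ Icc (0 : ℝ) 1, 0 ≤ F x) (hF0 : F 0 ≤ 1) (hF1 : F 1 ≤ 0)
    (hFF : ∀ x ∈ Icc (0 : ℝ) 1, F (F x) = x) {x : ℝ} (hx : x ∈ Icc (0 : ℝ) 1) : inverse F x = F x := by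
  have hm : F x ∈ Icc (0 : ℝ) 1 :=
    ⟨h0 x hx, by linarith [le_one_sub_of_convexOn hc hF0 hF1 hx, hx.1]⟩
  refine le_antisymm (inverse_le hm (hFF x hx).le) (le_inverse hm.2 fun t ht h => ?_)
  rw [← hFF t ht]
  exact antitoneOn_of_convexOn hc h0 hF1 ⟨h0 t ht, h.trans hx.2⟩ hx h

end Involution

/-! ### The upper bound functions -/

section UpperBound

variable {σ c u : ℝ}

lemma fHatU_zero (hμ : 0 < c / σ) : fHatU σ c u 0 = 1 := by
  rw [fHatU, gaussianTradeoff_zero hμ]; ring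

lemma fHatU_mem_Icc (hu0 : 0 ≤ u) (hu1 : u ≤ 1) {x : ℝ} (hx : x ∈ Icc (0 : ℝ) 1) :
    fHatU σ c u x ∈ Icc (0 : ℝ) 1 := by
  have h1 := gaussianTradeoff_nonneg (μ := c / σ) hx.1
  have h2 := gaussianTradeoff_le (μ := c / σ) hx
  have h3 := mul_nonneg (sub_nonneg.2 hu1) h1
  have h4 := mul_le_mul_of_nonneg_left (h2.trans (sub_le_self 1 hx.1)) (sub_nonneg.2 hu1)
  constructor <;> · rw [fHatU]; linarith

lemma min_fHatU_inverse_mem_Icc (hu0 : 0 ≤ u) (hu1 : u ≤ 1) :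
    ∀ x ∈ Icc (0 : ℝ) 1, min (fHatU σ c u x) (inverse (fHatU σ c u) x) ∈ Icc (0 : ℝ) 1 :=
  fun x hx => ⟨le_min (fHatU_mem_Icc hu0 hu1 hx).1 (inverse_mem_Icc _ x).1,
    min_le_of_left_le (fHatU_mem_Icc hu0 hu1 hx).2⟩

lemma fU_le_fHatU (hu0 : 0 ≤ u) (hu1 : u ≤ 1) {x : ℝ} (hx : x ∈ Icc (0 : ℝ) 1) :
    fU σ c u x ≤ fHatU σ c u x :=
  (biconjugate_le (min_fHatU_inverse_mem_Icc hu0 hu1) hx).trans (min_le_left _ _)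

lemma fU_le_inverse (hu0 : 0 ≤ u) (hu1 : u ≤ 1) {x : ℝ} (hx : x ∈ Icc (0 : ℝ) 1) :
    fU σ c u x ≤ inverse (fHatU σ c u) x :=
  (biconjugate_le (min_fHatU_inverse_mem_Icc hu0 hu1) hx).trans (min_le_right _ _)

lemma convexOn_fU (hu0 : 0 ≤ u) (hu1 : u ≤ 1) : ConvexOn ℝ (Icc 0 1) (fU σ c u) :=
  convexOn_biconjugate (min_fHatU_inverse_mem_Icc hu0 hu1)

lemma fU_nonneg (hu0 : 0 ≤ u) (hu1 : u ≤ 1) {x : ℝ} (hx : x ∈ Icc (0 : ℝ) 1) :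
    0 ≤ fU σ c u x := by
  have := line_le_biconjugate (min_fHatU_inverse_mem_Icc (σ := σ) (c := c) hu0 hu1) (a := 0) (y := 0)
    (fun x hx => by rw [zero_mul, add_zero]; exact (min_fHatU_inverse_mem_Icc hu0 hu1 x hx).1) hx
  rwa [zero_mul, add_zero] at this

lemma fU_zero_le_one (hu0 : 0 ≤ u) (hu1 : u ≤ 1) : fU σ c u 0 ≤ 1 :=
  (fU_le_fHatU hu0 hu1 (by simp)).trans (fHatU_mem_Icc hu0 hu1 (by simp)).2

lemma fU_one_nonpos (hu0 : 0 ≤ u) (hu1 : u ≤ 1) : fU σ c u 1 ≤ 0 :=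
  (fU_le_inverse hu0 hu1 (by simp)).trans
    (inverse_le (by simp) (fHatU_mem_Icc hu0 hu1 (by simp)).2)

/-- The intercept at `0` of the supporting line of `f̂^U_c` with slope `-b`. -/
def lineIntercept (σ c u b : ℝ) : ℝ := u + (1 - u) * gaussInf (c / σ) (b / (1 - u))

lemma lineIntercept_sub_le (hμ : 0 < c / σ) (hu1 : u < 1) {b x : ℝ} (hb : 0 < b) (hx : 0 ≤ x) :
    lineIntercept σ c u b - b * x ≤ fHatU σ c u x := by
  have hv : 0 < 1 - u := sub_pos.2 hu1
  have h := mul_le_mul_of_nonneg_left (gaussInf_sub_le hμ (div_pos hb hv) hx) hv.le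
  rw [mul_sub, ← mul_assoc, mul_div_cancel₀ _ hv.ne'] at h
  rw [lineIntercept, fHatU]
  linarith

lemma lineIntercept_le_one (hμ : 0 < c / σ) (hu1 : u < 1) {b : ℝ} (hb : 0 < b) :
    lineIntercept σ c u b ≤ 1 := by
  have := lineIntercept_sub_le hμ hu1 hb le_rfl
  rw [fHatU_zero hμ] at this
  linarith

lemma lineIntercept_le_mul (hμ : 0 < c / σ) (hu0 : 0 ≤ u) (hu1 : u < 1) {b : ℝ} (hb : 1 ≤ b) :
    lineIntercept σ c u b ≤ b * lineIntercept σ c u b⁻¹ := by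
  have := mix_gaussInf_le hμ (sub_pos.2 hu1) (by linarith) hb
  rwa [sub_sub_cancel] at this

/-- The line lies below the mixture by construction. It lies below the inverse because the reflected
supporting line of slope `-1/b` has slope `-b` and intercept `b * lineIntercept σ c u b⁻¹`, which is
no smaller for `b ≥ 1`. -/
lemma lineIntercept_sub_le_fU (hμ : 0 < c / σ) (hu0 : 0 ≤ u) (hu1 : u < 1) {b x : ℝ} (hb : 1 ≤ b)
    (hx : x ∈ Icc (0 : ℝ) 1) : lineIntercept σ c u b - b * x ≤ fU σ c u x := by
  have hb0 : 0 < b := by linarith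
  have hm := lineIntercept_le_mul hμ hu0 hu1 hb
  have := line_le_biconjugate (min_fHatU_inverse_mem_Icc hu0 hu1.le) (a := lineIntercept σ c u b)
    (y := -b) (f := fun α => min (fHatU σ c u α) (inverse (fHatU σ c u) α)) ?_ hx
  · rw [fU]; linarith
  refine fun x hx => le_min (by linarith [lineIntercept_sub_le hμ hu1 hb0 hx.1])
    (le_inverse ?_ fun t ht h => ?_)
  · nlinarith [lineIntercept_le_one hμ hu1 hb0, hx.1]
  · have h1 := mul_le_mul_of_nonneg_left
      ((lineIntercept_sub_le hμ hu1 (inv_pos.2 hb0) ht.1).trans h) hb0.le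
    rw [mul_sub, mul_inv_cancel_left₀ hb0.ne'] at h1
    linarith

/-- The mirror image in the diagonal of the preceding line is also a minorant, since the roles of
the mixture and its inverse are exchanged. -/
lemma lineIntercept_sub_le_mul_fU (hμ : 0 < c / σ) (hu0 : 0 ≤ u) (hu1 : u < 1) {b x : ℝ}
    (hb : 1 ≤ b) (hx : x ∈ Icc (0 : ℝ) 1) : lineIntercept σ c u b - x ≤ b * fU σ c u x := by
  have hb0 : 0 < b := by linarith
  have hm := lineIntercept_le_mul hμ hu0 hu1 hb
  have := line_le_biconjugate (min_fHatU_inverse_mem_Icc hu0 hu1.le)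
    (a := b⁻¹ * lineIntercept σ c u b)
    (y := -b⁻¹) (f := fun α => min (fHatU σ c u α) (inverse (fHatU σ c u) α)) ?_ hx
  · have h1 := mul_le_mul_of_nonneg_left this hb0.le
    rw [mul_add, mul_inv_cancel_left₀ hb0.ne', neg_mul, mul_neg, mul_inv_cancel_left₀ hb0.ne'] at h1
    exact h1
  have key : ∀ x y : ℝ, lineIntercept σ c u b - x ≤ b * y →
      b⁻¹ * lineIntercept σ c u b + -b⁻¹ * x ≤ y := fun x y h => by
    have := mul_le_mul_of_nonneg_left h (inv_pos.2 hb0).le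
    rw [inv_mul_cancel_left₀ hb0.ne'] at this
    linarith
  refine fun x hx => le_min (key _ _ ?_) (le_inverse (key _ _ ?_) fun t ht h => key _ _ ?_)
  · have h1 := mul_le_mul_of_nonneg_left
      (lineIntercept_sub_le hμ hu1 (inv_pos.2 hb0) hx.1) hb0.le
    rw [mul_sub, mul_inv_cancel_left₀ hb0.ne'] at h1
    linarith
  · linarith [lineIntercept_le_one hμ hu1 hb0, hx.1]
  · linarith [lineIntercept_sub_le hμ hu1 hb0 ht.1]

lemma lineIntercept_exp (hμ : 0 < c / σ) (hu1 : u < 1) (t : ℝ) :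
    lineIntercept σ c u ((1 - u) * Real.exp (c / σ * t - (c / σ) ^ 2 / 2)) =
      u + (1 - u) * Phi (t - c / σ) +
        (1 - u) * Real.exp (c / σ * t - (c / σ) ^ 2 / 2) * (1 - Phi t) := by
  rw [lineIntercept, mul_div_cancel_left₀ _ (sub_pos.2 hu1).ne', gaussInf_exp hμ]
  ring

/-! ### The breakpoints -/

lemma beta0_eq : beta0 σ c u = 1 - Phi (c / σ / 2 - Real.log (1 - u) / (c / σ)) := by
  rw [beta0]
  congr 2
  rw [div_div, mul_comm σ 2, div_div_eq_mul_div, mul_comm (Real.log _)]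
  ring

/-- The tangent of the mixture at `1 - Φ(t)` has slope at most `-1` exactly when `t` is at least the
threshold that defines `beta0`. -/
lemma one_le_mul_exp_iff (hμ : 0 < c / σ) (hu1 : u < 1) (t : ℝ) :
    1 ≤ (1 - u) * Real.exp (c / σ * t - (c / σ) ^ 2 / 2) ↔
      c / σ / 2 - Real.log (1 - u) / (c / σ) ≤ t := by
  have hv : 0 < 1 - u := sub_pos.2 hu1
  have h : (1 - u) * Real.exp (c / σ * t - (c / σ) ^ 2 / 2) =
      Real.exp (Real.log (1 - u) + (c / σ * t - (c / σ) ^ 2 / 2)) := by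
    rw [Real.exp_add, Real.exp_log hv]
  rw [h, Real.one_le_exp_iff]
  have h2 : Real.log (1 - u) + (c / σ * t - (c / σ) ^ 2 / 2) =
      c / σ * (t - (c / σ / 2 - Real.log (1 - u) / (c / σ))) := by
    generalize c / σ = μ at *
    field_simp
    ring
  rw [h2, mul_nonneg_iff_of_pos_left hμ, sub_nonneg]

lemma beta1_eq (hμ : 0 < c / σ) : beta1 σ c u = fHatU σ c u (beta0 σ c u) := by
  rw [beta0_eq, fHatU, gaussianTradeoff_one_sub_Phi hμ, beta1]
  congr 2
  rw [← Phi_neg]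
  congr 1
  rw [← div_div c 2 σ, div_right_comm, div_div_eq_mul_div, mul_comm (Real.log _)]
  ring

lemma beta0_nonneg : 0 ≤ beta0 σ c u := by
  rw [beta0]; linarith [Phi_le_one (c / (2 * σ) - σ / c * Real.log (1 - u))]

lemma beta0_le_beta1 (hμ : 0 < c / σ) (hu0 : 0 ≤ u) (hu1 : u < 1) :
    beta0 σ c u ≤ beta1 σ c u := by
  have hl : σ / c * Real.log (1 - u) ≤ 0 := by
    have : 0 < σ / c := by rw [← inv_div]; exact inv_pos.2 hμ
    exact mul_nonpos_of_nonneg_of_nonpos this.le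
      (Real.log_nonpos (by linarith) (by linarith))
  set l := σ / c * Real.log (1 - u)
  have h1 : Phi (c / (2 * σ)) ≤ Phi (c / (2 * σ) - l) := Phi_mono (by linarith)
  have h2 : Phi (c / (2 * σ) + l) ≤ Phi (c / (2 * σ)) := Phi_mono (by linarith)
  rw [beta0, beta1]
  have h3 := mul_le_mul_of_nonneg_left h2 (sub_pos.2 hu1).le
  have h4 := mul_nonneg hu0 (Phi_nonneg (c / (2 * σ)))
  change 1 - Phi (c / (2 * σ) - l) ≤ u + (1 - u) * (1 - Phi (c / (2 * σ) + l))
  linarith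

lemma beta1_le_one (hμ : 0 < c / σ) (hu0 : 0 ≤ u) (hu1 : u < 1) : beta1 σ c u ≤ 1 := by
  rw [beta1_eq hμ]
  refine (fHatU_mem_Icc hu0 hu1.le ⟨beta0_nonneg, ?_⟩).2
  rw [beta0]; linarith [Phi_nonneg (c / (2 * σ) - σ / c * Real.log (1 - u))]

lemma beta0_mem_Icc (hμ : 0 < c / σ) (hu0 : 0 ≤ u) (hu1 : u < 1) : beta0 σ c u ∈ Icc (0 : ℝ) 1 :=
  ⟨beta0_nonneg, (beta0_le_beta1 hμ hu0 hu1).trans (beta1_le_one hμ hu0 hu1)⟩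

lemma beta1_mem_Icc (hμ : 0 < c / σ) (hu0 : 0 ≤ u) (hu1 : u < 1) : beta1 σ c u ∈ Icc (0 : ℝ) 1 :=
  ⟨beta0_nonneg.trans (beta0_le_beta1 hμ hu0 hu1), beta1_le_one hμ hu0 hu1⟩

/-- The tangent of slope `-1` touches the mixture at `(β₀, β₁)`, where `β₁` is the value of the
mixture at `β₀`. -/
lemma lineIntercept_one (hμ : 0 < c / σ) (hu1 : u < 1) :
    lineIntercept σ c u 1 = beta0 σ c u + beta1 σ c u := by
  have hv : 0 < 1 - u := sub_pos.2 hu1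
  set t := c / σ / 2 - Real.log (1 - u) / (c / σ) with ht
  have h : (1 - u) * Real.exp (c / σ * t - (c / σ) ^ 2 / 2) = 1 := by
    have : c / σ * t - (c / σ) ^ 2 / 2 = -Real.log (1 - u) := by
      rw [ht]
      generalize c / σ = μ at *
      field_simp
      ring
    rw [this, Real.exp_neg, Real.exp_log hv, mul_inv_cancel₀ hv.ne']
  have h2 := lineIntercept_exp (σ := σ) hμ hu1 t
  rw [h] at h2
  rw [h2, beta1_eq hμ, fHatU, beta0_eq, gaussianTradeoff_one_sub_Phi hμ]
  ring

/-- For `0 < s` the tangent at `s` serves with no error. The `ε` is there for `s = 0`, where steeper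
and steeper tangents have intercepts tending to `1`. -/
lemma exists_lineIntercept (hμ : 0 < c / σ) (hu0 : 0 ≤ u) (hu1 : u < 1) {s ε : ℝ} (hs : 0 ≤ s)
    (hs0 : s ≤ beta0 σ c u) (hε : 0 < ε) :
    ∃ b, 1 ≤ b ∧ fHatU σ c u s - ε ≤ lineIntercept σ c u b - b * s := by
  have hv : 0 < 1 - u := sub_pos.2 hu1
  set t₀ := c / σ / 2 - Real.log (1 - u) / (c / σ)
  have tangent : ∀ t, t₀ ≤ t → s = 1 - Phi t →
      ∃ b, 1 ≤ b ∧ fHatU σ c u s - ε ≤ lineIntercept σ c u b - b * s := fun t ht h => by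
    refine ⟨_, (one_le_mul_exp_iff hμ hu1 t).2 ht, ?_⟩
    rw [lineIntercept_exp hμ hu1, h, fHatU, gaussianTradeoff_one_sub_Phi hμ]
    linarith
  rcases hs0.eq_or_lt with rfl | hlt
  · exact tangent t₀ le_rfl beta0_eq
  rcases hs.eq_or_lt with rfl | hs
  · have h : Filter.Tendsto (fun t => Phi (t - c / σ)) Filter.atTop (nhds 1) :=
      tendsto_Phi_atTop.comp (Filter.tendsto_atTop_add_const_right _ _ Filter.tendsto_id)
    obtain ⟨t, h1, h2⟩ := ((h.eventually (lt_mem_nhds (show 1 - ε < 1 by linarith))).and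
      (Filter.eventually_ge_atTop t₀)).exists
    refine ⟨_, (one_le_mul_exp_iff hμ hu1 t).2 h2, ?_⟩
    rw [lineIntercept_exp hμ hu1, fHatU_zero hμ]
    have h3 := mul_nonneg (mul_pos hv (Real.exp_pos (c / σ * t - (c / σ) ^ 2 / 2))).le
      (sub_nonneg.2 (Phi_le_one t))
    nlinarith
  · have := (beta0_mem_Icc hμ hu0 hu1).2
    obtain ⟨t, ht⟩ := exists_Phi_eq (p := 1 - s) (by linarith) (by linarith)
    refine tangent t (le_of_not_gt fun hlt' => ?_) (by linarith)
    have := Phi_mono hlt'.le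
    have : beta0 σ c u = 1 - Phi t₀ := beta0_eq
    linarith

/-! ### Explicit form of the upper bound function -/

lemma fU_eq_fHatU (hμ : 0 < c / σ) (hu0 : 0 ≤ u) (hu1 : u < 1) {s : ℝ} (hs : 0 ≤ s)
    (hs0 : s ≤ beta0 σ c u) : fU σ c u s = fHatU σ c u s := by
  have hs1 : s ∈ Icc (0 : ℝ) 1 := ⟨hs, hs0.trans (beta0_mem_Icc hμ hu0 hu1).2⟩
  refine le_antisymm (fU_le_fHatU hu0 hu1.le hs1) (le_of_forall_pos_le_add fun ε hε => ?_)
  obtain ⟨b, hb, h⟩ := exists_lineIntercept hμ hu0 hu1 hs hs0 hε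
  linarith [lineIntercept_sub_le_fU hμ hu0 hu1 hb hs1]

lemma fU_fHatU (hμ : 0 < c / σ) (hu0 : 0 ≤ u) (hu1 : u < 1) {s : ℝ} (hs : 0 ≤ s)
    (hs0 : s ≤ beta0 σ c u) : fU σ c u (fHatU σ c u s) = s := by
  have hs1 : s ∈ Icc (0 : ℝ) 1 := ⟨hs, hs0.trans (beta0_mem_Icc hμ hu0 hu1).2⟩
  have hm := fHatU_mem_Icc (σ := σ) (c := c) hu0 hu1.le hs1
  refine le_antisymm ((fU_le_inverse hu0 hu1.le hm).trans (inverse_le hs1 le_rfl))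
    (le_of_forall_pos_le_add fun ε hε => ?_)
  obtain ⟨b, hb, h⟩ := exists_lineIntercept hμ hu0 hu1 hs hs0 hε
  have h1 := lineIntercept_sub_le_mul_fU hμ hu0 hu1 hb hm
  -- Since `b ≥ 1`, a gap larger than `ε` in `fU` becomes a gap larger than `ε` after multiplication
  -- by `b`.
  by_contra! h2
  have h3 := mul_lt_mul_of_pos_left h2 (show 0 < b by linarith)
  nlinarith

/-- As `G` is an involution, `G((x - u)/(1 - u))` is the preimage of `x` under the mixture; for `x ≥
β₁` it lies in `[0, β₀]`, where `fU_fHatU` applies. -/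
lemma eq_fHatU_of_beta1_le (hμ : 0 < c / σ) (hu0 : 0 ≤ u) (hu1 : u < 1) {x : ℝ}
    (hx : beta1 σ c u ≤ x) (hx1 : x ≤ 1) :
    0 ≤ gaussianTradeoff (c / σ) ((x - u) / (1 - u)) ∧
    gaussianTradeoff (c / σ) ((x - u) / (1 - u)) ≤ beta0 σ c u ∧
    fHatU σ c u (gaussianTradeoff (c / σ) ((x - u) / (1 - u))) = x := by
  have hv : 0 < 1 - u := sub_pos.2 hu1
  have hb := beta0_mem_Icc hμ hu0 hu1
  have hg : gaussianTradeoff (c / σ) (beta0 σ c u) ≤ (x - u) / (1 - u) := by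
    rw [le_div_iff₀ hv]
    rw [beta1_eq hμ, fHatU] at hx
    linarith
  have hg0 := gaussianTradeoff_nonneg (μ := c / σ) hb.1
  have hp : (x - u) / (1 - u) ∈ Icc (0 : ℝ) 1 :=
    ⟨hg0.trans hg, (div_le_one hv).2 (by linarith)⟩
  refine ⟨gaussianTradeoff_nonneg hp.1, ?_, ?_⟩
  · exact (tradeoff_anti _ _ hg0 hg).trans_eq (gaussianTradeoff_gaussianTradeoff hμ hb)
  · rw [fHatU, gaussianTradeoff_gaussianTradeoff hμ hp, mul_div_cancel₀ _ hv.ne']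
    ring

lemma fU_of_beta1_le (hμ : 0 < c / σ) (hu0 : 0 ≤ u) (hu1 : u < 1) {x : ℝ}
    (hx : beta1 σ c u ≤ x) (hx1 : x ≤ 1) :
    fU σ c u x = gaussianTradeoff (c / σ) ((x - u) / (1 - u)) := by
  obtain ⟨h1, h2, h3⟩ := eq_fHatU_of_beta1_le hμ hu0 hu1 hx hx1
  have := fU_fHatU hμ hu0 hu1 h1 h2
  rwa [h3] at this

lemma convexOn_le_chord {F : ℝ → ℝ} (hc : ConvexOn ℝ (Icc 0 1) F) {p q x : ℝ}
    (hp : p ∈ Icc (0 : ℝ) 1) (hq : q ∈ Icc (0 : ℝ) 1) (hx : x ∈ Icc p q)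
    (hFp : F p ≤ q) (hFq : F q ≤ p) : F x ≤ p + q - x := by
  rw [← segment_eq_Icc (hx.1.trans hx.2)] at hx
  obtain ⟨a, b, ha, hb, hab, rfl⟩ := hx
  have h := hc.2 hp hq ha hb hab
  simp only [smul_eq_mul] at h ⊢
  have h1 := mul_le_mul_of_nonneg_left hFp ha
  have h2 := mul_le_mul_of_nonneg_left hFq hb
  obtain rfl : b = 1 - a := by linarith
  linarith

lemma fU_beta0 (hμ : 0 < c / σ) (hu0 : 0 ≤ u) (hu1 : u < 1) :
    fU σ c u (beta0 σ c u) = beta1 σ c u := by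
  rw [fU_eq_fHatU hμ hu0 hu1 beta0_nonneg le_rfl, beta1_eq hμ]

lemma fU_beta1 (hμ : 0 < c / σ) (hu0 : 0 ≤ u) (hu1 : u < 1) :
    fU σ c u (beta1 σ c u) = beta0 σ c u := by
  rw [beta1_eq hμ, fU_fHatU hμ hu0 hu1 beta0_nonneg le_rfl]

lemma fU_middle (hμ : 0 < c / σ) (hu0 : 0 ≤ u) (hu1 : u < 1) {x : ℝ}
    (hx : x ∈ Icc (beta0 σ c u) (beta1 σ c u)) :
    fU σ c u x = beta0 σ c u + beta1 σ c u - x := by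
  have h0 := beta0_mem_Icc hμ hu0 hu1
  have h1 := beta1_mem_Icc hμ hu0 hu1
  refine le_antisymm (convexOn_le_chord (convexOn_fU hu0 hu1.le) h0 h1 hx
    (fU_beta0 hμ hu0 hu1).le (fU_beta1 hμ hu0 hu1).le) ?_
  have := lineIntercept_sub_le_fU hμ hu0 hu1 le_rfl ⟨h0.1.trans hx.1, hx.2.trans h1.2⟩
  rwa [lineIntercept_one hμ hu1, one_mul] at this

lemma fU_fU (hμ : 0 < c / σ) (hu0 : 0 ≤ u) (hu1 : u < 1) {x : ℝ} (hx : x ∈ Icc (0 : ℝ) 1) :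
    fU σ c u (fU σ c u x) = x := by
  rcases le_total x (beta0 σ c u) with h0 | h0
  · rw [fU_eq_fHatU hμ hu0 hu1 hx.1 h0, fU_fHatU hμ hu0 hu1 hx.1 h0]
  rcases le_total x (beta1 σ c u) with h1 | h1
  · rw [fU_middle hμ hu0 hu1 ⟨h0, h1⟩, fU_middle hμ hu0 hu1 ⟨by linarith, by linarith⟩]
    ring
  · obtain ⟨h2, h3, h4⟩ := eq_fHatU_of_beta1_le hμ hu0 hu1 h1 hx.2
    rw [fU_of_beta1_le hμ hu0 hu1 h1 hx.2, fU_eq_fHatU hμ hu0 hu1 h2 h3, h4]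

/-- Here the mixture is constantly `1` and its inverse drops from `1` to `0` at the point `1`, so `1
- x` is an affine minorant and also the chord of `fU`. -/
lemma fU_of_eq_one {x : ℝ} (hx : x ∈ Icc (0 : ℝ) 1) : fU σ c 1 x = 1 - x := by
  refine le_antisymm (le_one_sub_of_convexOn (convexOn_fU zero_le_one le_rfl)
    (fU_zero_le_one zero_le_one le_rfl) (fU_one_nonpos zero_le_one le_rfl) hx) ?_
  have := line_le_biconjugate (min_fHatU_inverse_mem_Icc (σ := σ) (c := c) zero_le_one le_rfl)
    (a := 1) (y := -1) (fun x hx => le_min (by rw [fHatU]; linarith [hx.1])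
      (le_inverse (by linarith [hx.1]) fun t ht h => by
        rw [fHatU] at h; linarith [ht.1])) hx
  rw [fU]
  linarith

lemma fU_involution (hμ : 0 < c / σ) (hu0 : 0 ≤ u) (hu1 : u ≤ 1) :
    ∀ x ∈ Icc (0 : ℝ) 1, fU σ c u (fU σ c u x) = x := by
  intro x hx
  rcases hu1.eq_or_lt with rfl | hu1
  · rw [fU_of_eq_one hx, fU_of_eq_one ⟨by linarith [hx.2], by linarith [hx.1]⟩, sub_sub_cancel]
  · exact fU_fU hμ hu0 hu1 hx

lemma le_fU (hμ : 0 < c / σ) (hu0 : 0 ≤ u) (hu1 : u ≤ 1) {h : ℝ → ℝ} (hh : IsTradeoff h)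
    (h1 : ∀ x ∈ Icc (0 : ℝ) 1, h x ≤ fHatU σ c u x)
    (h2 : ∀ x ∈ Icc (0 : ℝ) 1, h x ≤ inverse (fHatU σ c u) x) {x : ℝ} (hx : x ∈ Icc (0 : ℝ) 1) :
    h x ≤ fU σ c u x := by
  rcases hu1.eq_or_lt with rfl | hu1
  · rw [fU_of_eq_one hx]
    exact hh.le_one_sub x hx
  have hb0 := beta0_mem_Icc hμ hu0 hu1
  have hb1 := beta1_mem_Icc hμ hu0 hu1
  have right : ∀ x, beta1 σ c u ≤ x → x ≤ 1 → h x ≤ fU σ c u x := fun x hx hx1 => by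
    obtain ⟨h3, h4, h5⟩ := eq_fHatU_of_beta1_le hμ hu0 hu1 hx hx1
    rw [fU_of_beta1_le hμ hu0 hu1 hx hx1]
    exact (h2 x ⟨hb1.1.trans hx, hx1⟩).trans (inverse_le ⟨h3, h4.trans hb0.2⟩ h5.le)
  rcases le_total x (beta0 σ c u) with h3 | h3
  · rw [fU_eq_fHatU hμ hu0 hu1 hx.1 h3]
    exact h1 x hx
  rcases le_total x (beta1 σ c u) with h4 | h4
  · rw [fU_middle hμ hu0 hu1 ⟨h3, h4⟩]
    exact convexOn_le_chord hh.convex hb0 hb1 ⟨h3, h4⟩ ((h1 _ hb0).trans (beta1_eq hμ).ge)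
      ((right _ le_rfl hb1.2).trans (fU_beta1 hμ hu0 hu1).le)
  · exact right x h4 hx.2

end UpperBound

/-! ### Discreteness of the draws and total mass of the laws -/

instance finite_draw (N B m : ℕ) : Finite (Draw N B m) :=
  Finite.of_injective (fun x : Draw N B m => (x.perm, x.sets)) fun x y h => by
    cases x; cases y; simp_all

instance discreteMeasurableSpace_draw (N B m : ℕ) : DiscreteMeasurableSpace (Draw N B m) :=
  ⟨fun _ => trivial⟩

namespace Framework

variable {n : ℕ} {Ω : Type*} [MeasurableSpace Ω] (M : Framework n Ω)

instance isProbabilityMeasure_drawLaw : IsProbabilityMeasure M.drawLaw := by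
  unfold drawLaw; infer_instance

instance isProbabilityMeasure_coinLaw : IsProbabilityMeasure M.coinLaw := by
  have := M.coin_prob
  unfold coinLaw; infer_instance

instance isProbabilityMeasure_stdGaussian_map (a : ℝ) :
    IsProbabilityMeasure ((stdGaussian (Model n)).map fun z => a • z) :=
  Measure.isProbabilityMeasure_map (by fun_prop)

instance isProbabilityMeasure_noiseLaw : IsProbabilityMeasure M.noiseLaw := by
  unfold noiseLaw; infer_instance

/-! ### Linear statistics of the noise -/

/-- Independence factorizes the characteristic function over the rounds, and `hl` says that the
variances add up to `1`. -/
lemma noiseLaw_map_sum_inner {e : Model n} (he : ‖e‖ = 1) (l : M.Round → ℝ)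
    (hl : ∑ τ, (l τ * (2 * M.C * M.σ)) ^ 2 = 1) :
    M.noiseLaw.map (fun z => ∑ τ, l τ * inner ℝ (z τ) e) = gaussianReal 0 1 := by
  have hm : Measurable fun z : M.Transcript => ∑ τ, l τ * inner ℝ (z τ) e := by fun_prop
  have : IsProbabilityMeasure (M.noiseLaw.map fun z => ∑ τ, l τ * inner ℝ (z τ) e) :=
    Measure.isProbabilityMeasure_map hm.aemeasurable
  refine Measure.ext_of_charFun (funext fun t => ?_)
  rw [charFun_apply_real, integral_map hm.aemeasurable (by fun_prop), charFun_gaussianReal]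
  have h1 : ∀ z : M.Transcript,
      Complex.exp (t * ((∑ τ, l τ * inner ℝ (z τ) e : ℝ) : ℂ) * Complex.I) =
        ∏ τ, Complex.exp ((inner ℝ (z τ) ((t * l τ) • e) : ℝ) * Complex.I) := fun z => by
    rw [← Complex.exp_sum]
    congr 1
    push_cast
    rw [Finset.mul_sum, Finset.sum_mul]
    refine Finset.sum_congr rfl fun τ _ => ?_
    rw [real_inner_smul_right]
    push_cast
    ring
  simp_rw [h1]
  rw [noiseLaw, integral_fintype_prod_eq_prod
    fun τ (x : Model n) => Complex.exp ((inner ℝ x ((t * l τ) • e) : ℝ) * Complex.I)]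
  simp_rw [← charFun_apply, charFun_map_smul, charFun_stdGaussian]
  rw [← Complex.exp_sum]
  congr 1
  have h2 : ∀ τ, -((‖(2 * M.C * M.σ) • (t * l τ) • e‖ : ℝ) : ℂ) ^ 2 / 2 =
      ((-(t ^ 2 / 2) * (l τ * (2 * M.C * M.σ)) ^ 2 : ℝ) : ℂ) := fun τ => by
    rw [← Complex.ofReal_pow, norm_smul, norm_smul, he, mul_one, mul_pow, Real.norm_eq_abs,
      Real.norm_eq_abs, sq_abs, sq_abs]
    push_cast
    ring
  simp_rw [h2]
  rw [← Complex.ofReal_sum, ← Finset.mul_sum, hl]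
  push_cast
  simp

lemma noiseLaw_lt_sum_inner {e : Model n} (he : ‖e‖ = 1) (l : M.Round → ℝ)
    (hl : ∑ τ, (l τ * (2 * M.C * M.σ)) ^ 2 = 1) (t : ℝ) :
    M.noiseLaw {z | t < ∑ τ, l τ * inner ℝ (z τ) e} = ENNReal.ofReal (1 - Phi t) := by
  have hm : Measurable fun z : M.Transcript => ∑ τ, l τ * inner ℝ (z τ) e := by fun_prop
  have h := gaussianReal_real_Ioi 0 t
  rw [sub_zero] at h
  rw [← h, ofReal_measureReal, ← M.noiseLaw_map_sum_inner he l hl,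
    Measure.map_apply hm measurableSet_Ioi]
  rfl

/-! ### Runs whose updates do not depend on the model -/

section Run

variable {X : Type*} {A : Ω → Model n → Finset X → Model n} {r : Fin M.N ↪ X}

/-- When the updates ignore the model and the past, the interrupts and step sizes leave no trace in
the transcript: it is a fixed signal plus noise. -/
lemma run_snd_apply {x : M.Draws} {ω : M.Coins} {u : M.Transcript}
    (hu : ∀ τ past w, M.update A r x ω τ past w = u τ) (z : M.Transcript) (t : ℕ) (τ : M.Round) :
    (M.run A r x ω z t).2 τ = if τ.val < t then u τ + z τ else 0 := by
  induction t with
  | zero => simp [run]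
  | succ t ih =>
    rw [run]
    split_ifs with ht h1 h1
    · dsimp only
      rw [hu]
      by_cases h : τ = ⟨t, ht⟩
      · subst h; simp
      · have h2 : τ.val < t := lt_of_le_of_ne (Nat.lt_succ_iff.1 h1) fun h3 => h (Fin.ext h3)
        rw [Function.update_of_ne h, ih, if_pos h2]
    · dsimp only
      have h : τ ≠ ⟨t, ht⟩ := fun h => h1 (h ▸ Nat.lt_succ_self t)
      rw [Function.update_of_ne h, ih, if_neg fun h2 => h1 (h2.trans (Nat.lt_succ_self t))]
    · rw [ih, if_pos (τ.isLt.trans_le (not_lt.1 ht))]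
    · exact absurd (τ.isLt.trans_le ((not_lt.1 ht).trans (Nat.le_succ t))) h1

lemma view_eq_map {u : M.Draws → M.Transcript}
    (hu : ∀ x ω τ past w, M.update A r x ω τ past w = u x τ) :
    M.view A r = (M.drawLaw.prod (M.coinLaw.prod M.noiseLaw)).map fun p =>
      (p.1, p.2.1, u p.1 + p.2.2) := by
  rw [view]
  congr 1
  ext p : 1
  congr 2
  ext τ : 1
  rw [M.run_snd_apply (hu p.1 p.2.1), if_pos τ.isLt]
  rfl

lemma measurable_observation (u : M.Draws → M.Transcript) :
    Measurable fun p : M.Draws × M.Coins × M.Transcript => (p.1, p.2.1, u p.1 + p.2.2) := by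
  have : Measurable u := .of_discrete
  fun_prop

lemma isProbabilityMeasure_view {u : M.Draws → M.Transcript}
    (hu : ∀ x ω τ past w, M.update A r x ω τ past w = u x τ) :
    IsProbabilityMeasure (M.view A r) := by
  rw [M.view_eq_map hu]
  exact Measure.isProbabilityMeasure_map (M.measurable_observation u).aemeasurable

end Run

/-! ### Counting the rounds that see a group -/

/-- `L_{b,e}` in terms of the number of the round. -/
def roundHits (g : ℕ) (x : M.Draws) (τ : M.Round) : ℕ := M.hits g x τ.divNat τ.modNat

/-- The sum of the squares of all `L_{b,e}`. -/
def sumSqHits (g : ℕ) (x : M.Draws) : ℝ := ∑ τ, (M.roundHits g x τ : ℝ) ^ 2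

/-- The sum of the squares of those `L_{b,e}` that are at most `g`. -/
def weightedCount (g : ℕ) (x : M.Draws) : ℝ :=
  ∑ k ∈ Finset.Icc 1 g, (M.count g x k : ℝ) * (k : ℝ) ^ 2

/-- The count `c_k` groups equal hit numbers, and rounds with hit number outside `[1, g]` contribute
nonnegatively on the right. So the event of large `weightedCount`, which `q` controls, forces a
large Gaussian shift. -/
lemma weightedCount_le_sumSqHits (g : ℕ) (x : M.Draws) :
    M.weightedCount g x ≤ M.sumSqHits g x := by
  have h1 : M.sumSqHits g x = ∑ p : Fin M.E × Fin M.B, (M.hits g x p.1 p.2 : ℝ) ^ 2 :=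
    Fintype.sum_equiv finProdFinEquiv.symm _ _ fun _ => rfl
  have h2 : M.weightedCount g x = ∑ p : Fin M.E × Fin M.B,
      ∑ k ∈ Finset.Icc 1 g, if M.hits g x p.1 p.2 = k then (k : ℝ) ^ 2 else 0 := by
    rw [Finset.sum_comm, weightedCount]
    refine Finset.sum_congr rfl fun k _ => ?_
    rw [count, ← Finset.sum_filter, Finset.sum_const, nsmul_eq_mul]
  rw [h1, h2]
  refine Finset.sum_le_sum fun p _ => ?_
  rw [Finset.sum_ite_eq]
  split_ifs
  · rfl
  · positivity

lemma weightedCount_nonneg (g : ℕ) (x : M.Draws) : 0 ≤ M.weightedCount g x :=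
  Finset.sum_nonneg fun _ _ => by positivity

lemma countable_cSet (g : ℕ) : (cSet g).Countable := by
  refine (countable_range fun j : ℕ => √(j : ℝ)).mono ?_
  rintro _ ⟨a, rfl⟩
  exact ⟨∑ k ∈ Finset.Icc 1 g, a k * k ^ 2, by push_cast; rfl⟩

/-- A union bound over the values of `√(∑ c_k k²)`, which form a countable set as square roots of
natural numbers. -/
lemma drawLaw_sqrt_weightedCount_lt (g : ℕ) (c : ℝ) :
    M.drawLaw {x | √(M.weightedCount g x) < c} ≤
      ∑' a : {a : ℝ // a ∈ cSet g ∧ a < c}, M.q g a := by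
  have : Countable {a : ℝ // a ∈ cSet g ∧ a < c} :=
    ((countable_cSet g).mono fun a (h : a ∈ cSet g ∧ a < c) => h.1).to_subtype
  refine (measure_mono fun x hx => ?_).trans (measure_iUnion_le fun a : {a : ℝ // a ∈ cSet g ∧ a < c}
    => {x | (a : ℝ) ^ 2 = ∑ k ∈ Finset.Icc 1 g, (M.count g x k : ℝ) * (k : ℝ) ^ 2})
  exact mem_iUnion.2 ⟨⟨√(M.weightedCount g x), ⟨fun k => M.count g x k, rfl⟩, hx⟩,
    Real.sq_sqrt (M.weightedCount_nonneg g x)⟩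

end Framework

namespace Framework

variable {n : ℕ} {Ω : Type*} [MeasurableSpace Ω] (M : Framework n Ω)

/-! ### The worst-case algorithm -/

open Classical in
/-- The algorithm that returns `v` if it sees one of the first `g` samples of `r`, that returns `-v`
if it sees one of the first `g` samples of `r'`, and that returns `0` otherwise. -/
def detector {X : Type*} {N : ℕ} (g : ℕ) (v : Model n) (r r' : Fin N ↪ X) (Y : Finset X) :
    Model n :=
  if ∃ i : Fin N, (i : ℕ) < g ∧ r i ∈ Y then v
  else if ∃ i : Fin N, (i : ℕ) < g ∧ r' i ∈ Y then -v else 0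

lemma clip_of_norm_eq {C : ℝ} (hC : 0 < C) {v : Model n} (hv : ‖v‖ = C) : clip C v = v := by
  rw [clip, hv, div_self hC.ne', max_self, inv_one, one_smul]

lemma clip_zero (C : ℝ) : clip C (0 : Model n) = 0 := smul_zero _

section Detector

variable {X : Type*} {g : ℕ} {r r' : Fin M.N ↪ X}

lemma exists_mem_batch_self (x : M.Draws) (τ : M.Round) (h : Fin M.m) :
    (∃ i : Fin M.N, (i : ℕ) < g ∧ r i ∈ M.batch r x τ h) ↔
      ∃ i ∈ (x τ.divNat).sets τ.modNat h, ((x τ.divNat).perm i : ℕ) < g := by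
  simp only [batch, Finset.mem_map, exists_exists_and_eq_and, Equiv.coe_toEmbedding,
    EmbeddingLike.apply_eq_iff_eq]
  constructor
  · rintro ⟨i, hi, j, hj, rfl⟩
    exact ⟨j, hj, hi⟩
  · rintro ⟨j, hj, hi⟩
    exact ⟨_, hi, j, hj, rfl⟩

lemma not_exists_mem_batch (hr : ∀ i j : Fin M.N, (i : ℕ) < g → r i ≠ r' j) (x : M.Draws) (τ : M.Round)
    (h : Fin M.m) : ¬∃ i : Fin M.N, (i : ℕ) < g ∧ r i ∈ M.batch r' x τ h := by
  rintro ⟨i, hi, hm⟩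
  obtain ⟨j, -, hj⟩ := Finset.mem_map.1 hm
  exact hr i j hi hj.symm

lemma update_detector_left {v : Model n} (hv : ‖v‖ = M.C)
    (hr : ∀ i j : Fin M.N, (i : ℕ) < g → r' i ≠ r j) (x : M.Draws) (ω : M.Coins)
    (τ : M.Round) (past : M.Transcript) (w : Model n) :
    M.update (fun _ _ => detector g v r r') r x ω τ past w = (M.roundHits g x τ : ℝ) • v := by
  classical
  have h1 : ∀ h, clip M.C (detector g v r r' (M.batch r x τ h)) =
      if ∃ i ∈ (x τ.divNat).sets τ.modNat h, ((x τ.divNat).perm i : ℕ) < g then v else 0 :=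
    fun h => by
      rw [detector, if_neg (M.not_exists_mem_batch hr x τ h)]
      simp only [M.exists_mem_batch_self]
      split_ifs
      exacts [clip_of_norm_eq M.C_pos hv, clip_zero _]
  rw [update]
  simp only [h1]
  rw [← Finset.sum_filter, Finset.sum_const, ← Nat.cast_smul_eq_nsmul ℝ, roundHits, hits]

lemma update_detector_right {v : Model n} (hv : ‖v‖ = M.C)
    (hr : ∀ i j : Fin M.N, (i : ℕ) < g → r i ≠ r' j) (x : M.Draws) (ω : M.Coins)
    (τ : M.Round) (past : M.Transcript) (w : Model n) :
    M.update (fun _ _ => detector g v r r') r' x ω τ past w = (M.roundHits g x τ : ℝ) • -v := by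
  classical
  have h1 : ∀ h, clip M.C (detector g v r r' (M.batch r' x τ h)) =
      if ∃ i ∈ (x τ.divNat).sets τ.modNat h, ((x τ.divNat).perm i : ℕ) < g then -v else 0 :=
    fun h => by
      rw [detector, if_neg (M.not_exists_mem_batch hr x τ h)]
      simp only [M.exists_mem_batch_self]
      split_ifs
      exacts [clip_of_norm_eq M.C_pos (by rwa [norm_neg]), clip_zero _]
  rw [update]
  simp only [h1]
  rw [← Finset.sum_filter, Finset.sum_const, ← Nat.cast_smul_eq_nsmul ℝ, roundHits, hits]

end Detector

/-! ### The test of the adversary -/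

/-- Reject when at least `c²` was accumulated and the transcript is far in the direction `-e`. -/
def rejection (g : ℕ) (c t : ℝ) (e : Model n) : Set (M.Draws × M.Coins × M.Transcript) :=
  {p | c ≤ √(M.weightedCount g p.1) ∧ t - √(M.sumSqHits g p.1) / (2 * M.σ) <
    ∑ τ, -(M.roundHits g p.1 τ / (2 * M.C * M.σ * √(M.sumSqHits g p.1))) *
      inner ℝ (p.2.2 τ) e}

lemma measurableSet_rejection (g : ℕ) (c t : ℝ) (e : Model n) :
    MeasurableSet (M.rejection g c t e) := by
  have h1 : Measurable (M.weightedCount g) := .of_discrete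
  have h2 : Measurable (M.sumSqHits g) := .of_discrete
  have h3 : ∀ τ, Measurable fun x => (M.roundHits g x τ : ℝ) := fun _ => .of_discrete
  have h4 : ∀ τ, Measurable fun p : M.Draws × M.Coins × M.Transcript =>
      (M.roundHits g p.1 τ : ℝ) := fun τ => (h3 τ).comp measurable_fst
  have h5 : MeasurableSet {p : M.Draws × M.Coins × M.Transcript | c ≤ √(M.weightedCount g p.1)} :=
    measurableSet_le (by fun_prop) (by fun_prop)
  have h6 : Measurable fun p : M.Draws × M.Coins × M.Transcript =>
      ∑ τ, -(M.roundHits g p.1 τ / (2 * M.C * M.σ * √(M.sumSqHits g p.1))) *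
        inner ℝ (p.2.2 τ) e := by
    refine Finset.measurable_sum _ fun τ _ => ?_
    have := h4 τ
    fun_prop
  exact h5.inter (measurableSet_lt (by fun_prop) h6)

open Classical in
-- With the draw fixed and `s = √(∑ L²)`, the weights make the noise part standard normal and give
-- the statistic the mean `-δ s / (2σ)`. For `δ = 1` the threshold sits `t` above the mean; for `δ =
-- -1` it sits at `t - s / σ` relative to the mean.
lemma map_apply_rejection {g : ℕ} {c : ℝ} (hc : 0 < c) (t : ℝ) {e : Model n} (he : ‖e‖ = 1)
    (δ : ℝ) :
    (M.drawLaw.prod (M.coinLaw.prod M.noiseLaw)).map (fun p : M.Draws × M.Coins × M.Transcript =>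
      (p.1, p.2.1, (fun τ => (M.roundHits g p.1 τ : ℝ) • (δ * M.C) • e) + p.2.2))
      (M.rejection g c t e) =
    ∫⁻ x, (if c ≤ √(M.weightedCount g x) then
      ENNReal.ofReal (1 - Phi (t - √(M.sumSqHits g x) / (2 * M.σ) +
        δ * (√(M.sumSqHits g x) / (2 * M.σ)))) else 0) ∂M.drawLaw := by
  have hm := M.measurable_observation fun x τ => (M.roundHits g x τ : ℝ) • (δ * M.C) • e
  have hR := M.measurableSet_rejection g c t e
  rw [Measure.map_apply hm hR, Measure.prod_apply (hm hR)]
  refine lintegral_congr fun x => ?_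
  split_ifs with hx
  · have hs : 0 < √(M.sumSqHits g x) :=
      hc.trans_le (hx.trans (Real.sqrt_le_sqrt (M.weightedCount_le_sumSqHits g x)))
    have hs2 : √(M.sumSqHits g x) ^ 2 = ∑ τ, (M.roundHits g x τ : ℝ) ^ 2 :=
      Real.sq_sqrt (Real.sqrt_pos.1 hs).le
    set s := √(M.sumSqHits g x) with hsdef
    have hC := M.C_pos
    have hσ := M.σ_pos
    have hl : ∑ τ, (-(M.roundHits g x τ / (2 * M.C * M.σ * s)) * (2 * M.C * M.σ)) ^ 2 = 1 := by
      have : ∀ τ, (-(M.roundHits g x τ / (2 * M.C * M.σ * s)) * (2 * M.C * M.σ)) ^ 2 =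
          (M.roundHits g x τ : ℝ) ^ 2 / s ^ 2 := fun τ => by field_simp
      simp_rw [this]
      rw [← Finset.sum_div, ← hs2, div_self (pow_pos hs 2).ne']
    -- The test ignores the coins, whose total mass `1` is inserted to obtain a product set.
    rw [← M.noiseLaw_lt_sum_inner he _ hl, ← one_mul (M.noiseLaw _),
      ← measure_univ (μ := M.coinLaw), ← Measure.prod_prod]
    congr 1
    ext ⟨ω, z⟩
    have h1 : ∑ τ, -(M.roundHits g x τ / (2 * M.C * M.σ * s)) *
        inner ℝ ((M.roundHits g x τ : ℝ) • (δ * M.C) • e + z τ) e =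
        -(δ * (s / (2 * M.σ))) + ∑ τ, -(M.roundHits g x τ / (2 * M.C * M.σ * s)) *
          inner ℝ (z τ) e := by
      have h2 : δ * (s / (2 * M.σ)) =
          ∑ τ, δ / (2 * M.σ * s) * (M.roundHits g x τ : ℝ) ^ 2 := by
        rw [← Finset.mul_sum, ← hs2]; field_simp
      rw [h2, ← Finset.sum_neg_distrib, ← Finset.sum_add_distrib]
      refine Finset.sum_congr rfl fun τ _ => ?_
      rw [inner_add_left, real_inner_smul_left, real_inner_smul_left, real_inner_self_eq_norm_sq,
        he]
      field_simp
      ring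
    simp only [rejection, mem_preimage, mem_ofPred_eq, hx, true_and, mem_prod, mem_univ,
      Pi.add_apply, ← hsdef, h1]
    constructor <;> intro h <;> linarith
  · have : Prod.mk x ⁻¹' ((fun p : M.Draws × M.Coins × M.Transcript =>
      (p.1, p.2.1, (fun τ => (M.roundHits g p.1 τ : ℝ) • (δ * M.C) • e) + p.2.2)) ⁻¹'
        M.rejection g c t e) = ∅ := by
      ext p
      simp [rejection, hx]
    rw [this, measure_empty]

lemma exists_test {X : Type*} {g : ℕ} {r r' : Fin M.N ↪ X} (hr : ∀ i j : Fin M.N, (i : ℕ) < g → r i ≠ r' j)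
    (hr' : ∀ i j : Fin M.N, (i : ℕ) < g → r' i ≠ r j) {c u : ℝ} (hc : 0 < c) (hu0 : 0 ≤ u) (hu1 : u ≤ 1)
    (hu : M.drawLaw {x | √(M.weightedCount g x) < c} ≤ ENNReal.ofReal u)
    {e : Model n} (he : ‖e‖ = 1) {α : ℝ} (hα : α ∈ Icc (0 : ℝ) 1) :
    ∃ φ : M.Draws × M.Coins × M.Transcript → ℝ, Measurable φ ∧ (∀ o, φ o ∈ Icc (0 : ℝ) 1) ∧
      ∫ o, φ o ∂M.view (fun _ _ => detector g (M.C • e) r r') r ≤ α ∧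
      1 - ∫ o, φ o ∂M.view (fun _ _ => detector g (M.C • e) r r') r' ≤ fHatU M.σ c u α := by
  classical
  have hμ : 0 < c / M.σ := div_pos hc M.σ_pos
  have hv : ‖M.C • e‖ = M.C := by rw [norm_smul, he, mul_one, Real.norm_of_nonneg M.C_pos.le]
  have e1 := M.view_eq_map (A := fun _ _ => detector g (M.C • e) r r')
    (u := fun x τ => (M.roundHits g x τ : ℝ) • (1 * M.C) • e)
    fun x ω τ past w => by rw [M.update_detector_left hv hr', one_mul]
  have e2 := M.view_eq_map (A := fun _ _ => detector g (M.C • e) r r')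
    (u := fun x τ => (M.roundHits g x τ : ℝ) • (-1 * M.C) • e)
    fun x ω τ past w => by rw [M.update_detector_right hv hr, neg_one_mul, neg_smul]
  have p2 := M.isProbabilityMeasure_view (M.update_detector_right hv hr)
  -- The levels `0` and `1` correspond to no finite threshold; the constant tests `0` and `1` serve
  -- there.
  rcases hα.1.eq_or_lt with rfl | h0
  · exact ⟨fun _ => 0, measurable_const, by simp, by simp, by simp [fHatU_zero hμ]⟩
  have p1 := M.isProbabilityMeasure_view (M.update_detector_left hv hr')
  rcases hα.2.eq_or_lt with rfl | h1
  · exact ⟨fun _ => 1, measurable_const, by simp, by simp,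
      by simpa using (fHatU_mem_Icc hu0 hu1 hα).1⟩
  obtain ⟨t, ht⟩ := exists_Phi_eq (p := 1 - α) (by linarith) (by linarith)
  obtain rfl : α = 1 - Phi t := by linarith
  have hR := M.measurableSet_rejection g c t e
  refine ⟨(M.rejection g c t e).indicator 1, measurable_one.indicator hR, fun o => ?_, ?_, ?_⟩
  · by_cases ho : o ∈ M.rejection g c t e <;> simp [ho]
  · rw [integral_indicator_one hR, measureReal_def, e1, M.map_apply_rejection hc t he]
    refine ENNReal.toReal_le_of_le_ofReal hα.1 ?_
    calc _ ≤ ∫⁻ _, ENNReal.ofReal (1 - Phi t) ∂M.drawLaw := lintegral_mono fun x => by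
            dsimp only
            split_ifs
            · rw [one_mul, sub_add_cancel]
            · exact zero_le
      _ = _ := by simp
  · rw [integral_indicator_one hR, measureReal_def, e2, M.map_apply_rejection hc t he, fHatU,
      gaussianTradeoff_one_sub_Phi hμ]
    set S : Set M.Draws := {x | √(M.weightedCount g x) < c}
    set q := 1 - Phi (t - c / M.σ) with hq
    have hq0 : 0 ≤ q := by linarith [Phi_le_one (t - c / M.σ)]
    -- Off `S` the shift is at least `c / σ`, so the power is at least `q`; on `S` the test never
    -- rejects.
    have hle : ENNReal.ofReal q * M.drawLaw Sᶜ ≤ ∫⁻ x, (if c ≤ √(M.weightedCount g x) then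
      ENNReal.ofReal (1 - Phi (t - √(M.sumSqHits g x) / (2 * M.σ) +
        -1 * (√(M.sumSqHits g x) / (2 * M.σ)))) else 0) ∂M.drawLaw := by
      rw [← lintegral_indicator_const (.of_discrete)]
      refine lintegral_mono fun x => ?_
      by_cases hx : c ≤ √(M.weightedCount g x)
      · have hx' : x ∈ Sᶜ := not_lt.2 hx
        rw [indicator_of_mem hx', if_pos hx]
        refine ENNReal.ofReal_le_ofReal (sub_le_sub_left (Phi_mono ?_) 1)
        have h3 : c / M.σ ≤ √(M.sumSqHits g x) / M.σ := div_le_div_of_nonneg_right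
          (hx.trans (Real.sqrt_le_sqrt (M.weightedCount_le_sumSqHits g x))) M.σ_pos.le
        have h4 : √(M.sumSqHits g x) / (2 * M.σ) + √(M.sumSqHits g x) / (2 * M.σ) =
          √(M.sumSqHits g x) / M.σ := by
          have := M.σ_pos
          field_simp; ring
        linarith
      · have hx' : x ∉ Sᶜ := fun h => h (not_le.1 hx)
        rw [indicator_of_notMem hx', if_neg hx]
    have hne : ∫⁻ x, (if c ≤ √(M.weightedCount g x) then
      ENNReal.ofReal (1 - Phi (t - √(M.sumSqHits g x) / (2 * M.σ) +
        -1 * (√(M.sumSqHits g x) / (2 * M.σ)))) else 0) ∂M.drawLaw ≠ ⊤ := by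
      rw [← M.map_apply_rejection hc t he, ← e2]
      exact measure_ne_top _ _
    have h5 := ENNReal.toReal_mono hne hle
    rw [ENNReal.toReal_mul, ENNReal.toReal_ofReal hq0, ← measureReal_def,
      probReal_compl_eq_one_sub (.of_discrete)] at h5
    have h6 : M.drawLaw.real S ≤ u := ENNReal.toReal_le_of_le_ofReal hu0 hu
    have h7 := mul_le_mul_of_nonneg_left h6 hq0
    have h8 : Phi (t - c / M.σ) = 1 - q := by rw [hq]; ring
    rw [h8]
    linarith

end Framework

/-! ### Neighboring data sets without common samples among the first `g` indices -/

lemma exists_disjoint_pair {X : Type*} {N g : ℕ} (hg : g ≤ N) (f : Fin (N + g) ↪ X) :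
    ∃ (d d' : Finset X) (r r' : Fin N ↪ X), IsGroupPair g N d d' r r' ∧
      IsGroupPair g N d' d r' r ∧
      (∀ i j : Fin N, (i : ℕ) < g → r i ≠ r' j) ∧ ∀ i j : Fin N, (i : ℕ) < g → r' i ≠ r j := by
  classical
  -- One listing uses the first `N` of the `N + g` distinct samples. The other replaces the sample
  -- at each index `i < g` by the fresh sample `N + i`.
  let k : Fin N → Fin (N + g) := fun i =>
    if h : (i : ℕ) < g then Fin.natAdd N ⟨i, h⟩ else Fin.castAdd g i
  have hk1 : ∀ i : Fin N, (i : ℕ) < g → (k i : ℕ) = N + i := fun i hi => by simp [k, hi]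
  have hk2 : ∀ i : Fin N, ¬(i : ℕ) < g → (k i : ℕ) = i := fun i hi => by simp [k, hi]
  have hk : Function.Injective k := fun i j hij => by
    have h := congrArg Fin.val hij
    have := i.isLt
    have := j.isLt
    ext
    by_cases hi : (i : ℕ) < g <;> by_cases hj : (j : ℕ) < g
    · rw [hk1 i hi, hk1 j hj] at h; omega
    · rw [hk1 i hi, hk2 j hj] at h; omega
    · rw [hk2 i hi, hk1 j hj] at h; omega
    · rw [hk2 i hi, hk2 j hj] at h; omega
  let r : Fin N ↪ X := (Fin.castAddEmb g).trans f
  let r' : Fin N ↪ X := (⟨k, hk⟩ : Fin N ↪ Fin (N + g)).trans f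
  have hrr : ∀ i j, r i = r' j ↔ (i : ℕ) = k j := fun i j => by
    simp [r, r', Fin.ext_iff]
  have h1 : ∀ i j : Fin N, (i : ℕ) < g → r i ≠ r' j := fun i j hi h => by
    rw [hrr] at h
    by_cases hj : (j : ℕ) < g
    · rw [hk1 j hj] at h; omega
    · rw [hk2 j hj] at h; omega
  have h2 : ∀ i j : Fin N, (i : ℕ) < g → r' i ≠ r j := fun i j hi h => by
    have := (hrr j i).1 h.symm
    rw [hk1 i hi] at this
    omega
  have h3 : ∀ i : Fin N, ¬(i : ℕ) < g → r i = r' i := fun i hi => (hrr i i).2 (hk2 i hi).symm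
  have hcard : ∀ s : Fin N ↪ X, (Finset.univ.map s).card = N := fun s => by simp
  have hinter : Finset.univ.map r ∩ Finset.univ.map r' =
      (Finset.univ.filter fun i : Fin N => ¬(i : ℕ) < g).map r := by
    ext y
    simp only [Finset.mem_inter, Finset.mem_map, Finset.mem_univ, true_and, Finset.mem_filter]
    constructor
    · rintro ⟨⟨i, rfl⟩, ⟨j, hj⟩⟩
      exact ⟨i, fun hi => h1 i j hi hj.symm, rfl⟩
    · rintro ⟨i, hi, rfl⟩
      exact ⟨⟨i, rfl⟩, ⟨i, (h3 i hi).symm⟩⟩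
  have hlt : (Finset.univ.filter fun i : Fin N => (i : ℕ) < g).card = g := by
    rw [Fin.card_filter_val_lt, min_eq_right hg]
  have hint : (Finset.univ.map r ∩ Finset.univ.map r').card + g = N := by
    rw [hinter, Finset.card_map]
    have := Finset.card_filter_add_card_filter_not (s := (Finset.univ : Finset (Fin N)))
      (fun i => (i : ℕ) < g)
    rw [hlt, Finset.card_univ, Fintype.card_fin] at this
    omega
  have hd1 := Finset.card_sdiff_add_card_inter (Finset.univ.map r) (Finset.univ.map r')
  have hd2 := Finset.card_sdiff_add_card_inter (Finset.univ.map r') (Finset.univ.map r)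
  have hint' := hint
  rw [Finset.inter_comm] at hint'
  rw [hcard] at hd1 hd2
  refine ⟨Finset.univ.map r, Finset.univ.map r', r, r', ⟨?_, ?_, rfl, rfl, fun i hi => ?_⟩,
    ⟨?_, ?_, rfl, rfl, fun i hi => ?_⟩, h1, h2⟩
  · exact max_le (by omega) (by omega)
  · convert hint.symm
  · refine h3 i fun hlt => ?_
    rcases hi with hi | hi <;> rw [Finset.mem_inter] at hi
    · obtain ⟨j, -, hj⟩ := Finset.mem_map.1 hi.2
      exact h1 i j hlt hj.symm
    · obtain ⟨j, -, hj⟩ := Finset.mem_map.1 hi.1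
      exact h2 i j hlt hj.symm
  · exact max_le (by omega) (by omega)
  · convert hint'.symm
  · refine (h3 i fun hlt => ?_).symm
    rcases hi with hi | hi <;> rw [Finset.mem_inter] at hi
    · obtain ⟨j, -, hj⟩ := Finset.mem_map.1 hi.2
      exact h2 i j hlt hj.symm
    · obtain ⟨j, -, hj⟩ := Finset.mem_map.1 hi.1
      exact h1 i j hlt hj.symm

lemma IsGroupDP.le_fHatU_and_le_inverse {n : ℕ} (hn : 1 ≤ n) {Ω : Type*} [MeasurableSpace Ω]
    {M : Framework n Ω} {X : Type*} {g : ℕ} (hg : g ≤ M.N) (f : Fin (M.N + g) ↪ X)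
    {c u : ℝ} (hc : 0 < c) (hu0 : 0 ≤ u) (hu1 : u ≤ 1)
    (hu : ∑' a : {a : ℝ // a ∈ cSet g ∧ a < c}, M.q g a ≤ ENNReal.ofReal u)
    {h : ℝ → ℝ} (hh : IsGroupDP M X g h) {x : ℝ} (hx : x ∈ Icc (0 : ℝ) 1) :
    h x ≤ fHatU M.σ c u x ∧ h x ≤ inverse (fHatU M.σ c u) x := by
  obtain ⟨d, d', r, r', hd, hd', hr, hr'⟩ := exists_disjoint_pair hg f
  let e : Model n := EuclideanSpace.single ⟨0, hn⟩ 1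
  have he : ‖e‖ = 1 := by simp [e]
  have hu' := (M.drawLaw_sqrt_weightedCount_lt g c).trans hu
  have hv : ‖M.C • e‖ = M.C := by rw [norm_smul, he, mul_one, Real.norm_of_nonneg M.C_pos.le]
  have p1 := M.isProbabilityMeasure_view (M.update_detector_left hv hr')
  have p2 := M.isProbabilityMeasure_view (M.update_detector_right hv hr)
  have hA : ∀ Y, Measurable fun p : Ω × Model n =>
    (fun _ _ => Framework.detector g (M.C • e) r r' : Ω → Model n → Finset X → Model n) p.1 p.2 Y :=
    fun Y => measurable_const
  constructor
  · obtain ⟨φ, h1, h2, h3, h4⟩ := M.exists_test hr hr' hc hu0 hu1 hu' he hx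
    exact ((hh.2 _ hA d d' r r' hd x hx).trans (tradeoff_le _ _ h1 h2 h3)).trans h4
  · refine le_inverse ((hh.1.le_one_sub x hx).trans (by linarith [hx.1])) fun t ht hle => ?_
    obtain ⟨φ, h1, h2, h3, h4⟩ := M.exists_test hr hr' hc hu0 hu1 hu' he ht
    -- For the exchanged pair the test `1 - φ` swaps the two errors: its level is the second error
    -- of `φ`, at most `x`, and its second error is the level of `φ`, at most `t`.
    have h5 := tradeoff_le (M.view (fun _ _ => Framework.detector g (M.C • e) r r') r')
      (M.view (fun _ _ => Framework.detector g (M.C • e) r r') r) (α := x) (φ := fun o => 1 - φ o)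
      (measurable_const.sub h1) (fun o => ⟨by linarith [(h2 o).2], by linarith [(h2 o).1]⟩)
      (by
        rw [integral_sub (integrable_const _) (integrable_of_mem_Icc _ h1 h2)]
        simpa using h4.trans hle)
    rw [integral_sub (integrable_const _) (integrable_of_mem_Icc _ h1 h2)] at h5
    simp only [integral_const, probReal_univ, smul_eq_mul, mul_one, sub_sub_cancel] at h5
    exact ((hh.2 _ hA d' d r' r hd' x hx).trans h5).trans h3

end DPSGD

end

/-! ### The theorem -/

theorem theorem1 {n : ℕ} (hn : 1 ≤ n) {Ω : Type*} [MeasurableSpace Ω] (M : Framework n Ω)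
    {X : Type*} (g : ℕ) (hg : g ≤ M.N) (hX : Nonempty (Fin (M.N + g) ↪ X))
    (c u : ℝ) (hc : 0 < c) (hu0 : 0 ≤ u) (hu1 : u ≤ 1)
    (hu : ∑' a : {a : ℝ // a ∈ cSet g ∧ a < c}, M.q g a ≤ ENNReal.ofReal u)
    (h : ℝ → ℝ) (hh : IsGroupDP M X g h) :
    (∀ α ∈ Set.Icc (0 : ℝ) 1, h α ≤ fU M.σ c u α ∧ fU M.σ c u α ≤ fHatU M.σ c u α) ∧
    IsTradeoff (fU M.σ c u) ∧
    (∀ α ∈ Set.Icc (0 : ℝ) 1, inverse (fU M.σ c u) α = fU M.σ c u α) ∧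
    (u < 1 →
      (0 ≤ beta0 M.σ c u ∧ beta0 M.σ c u ≤ beta1 M.σ c u ∧ beta1 M.σ c u ≤ 1) ∧
      ∀ α ∈ Set.Icc (0 : ℝ) 1,
        (α ≤ beta0 M.σ c u → fU M.σ c u α = u + (1 - u) * gaussianTradeoff (c / M.σ) α) ∧
        (beta0 M.σ c u ≤ α → α ≤ beta1 M.σ c u →
          fU M.σ c u α = beta0 M.σ c u + beta1 M.σ c u - α) ∧
        (beta1 M.σ c u ≤ α →
          fU M.σ c u α = gaussianTradeoff (c / M.σ) ((α - u) / (1 - u)))) ∧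
    (u = 1 → ∀ α ∈ Set.Icc (0 : ℝ) 1, fU M.σ c u α = 1 - α) := by
  have hμ : 0 < c / M.σ := div_pos hc M.σ_pos
  obtain ⟨f⟩ := hX
  have hb := fun x hx => IsGroupDP.le_fHatU_and_le_inverse hn hg f hc hu0 hu1 hu hh (x := x) hx
  have hcv := convexOn_fU (σ := M.σ) (c := c) hu0 hu1
  have hnn : ∀ x ∈ Set.Icc (0 : ℝ) 1, 0 ≤ fU M.σ c u x := fun x hx => fU_nonneg hu0 hu1 hx
  have h0 := fU_zero_le_one (σ := M.σ) (c := c) hu0 hu1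
  have h1 := fU_one_nonpos (σ := M.σ) (c := c) hu0 hu1
  have hinv := fU_involution hμ hu0 hu1
  refine ⟨fun α hα => ⟨le_fU hμ hu0 hu1 hh.1 (fun x hx => (hb x hx).1) (fun x hx => (hb x hx).2) hα,
    fU_le_fHatU hu0 hu1 hα⟩, isTradeoff_of_involution hcv hnn h0 h1 hinv,
    fun α hα => inverse_eq_of_involution hcv hnn h0 h1 hinv hα, fun hlt => ⟨⟨beta0_nonneg,
    beta0_le_beta1 hμ hu0 hlt, beta1_le_one hμ hu0 hlt⟩, fun α hα =>
    ⟨fun h2 => fU_eq_fHatU hμ hu0 hlt hα.1 h2, fun h2 h3 => fU_middle hμ hu0 hlt ⟨h2, h3⟩,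
    fun h2 => fU_of_beta1_le hμ hu0 hlt h2 hα.2⟩⟩, ?_⟩
  rintro rfl α hα
  exact fU_of_eq_one hα
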